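/- Let $n\in\mathbb N$, $\eta>0$, and let $BUC_\eta$ be the Banach space of continuous $\varphi:(-\infty,0]\to\mathbb R^n$ such that $\theta\mapsto e^{\eta\theta}\varphi(\theta)$ is bounded and uniformly continuous, with norm $\|\varphi\|_\eta=\sup_{\theta\le 0}e^{\eta\theta}\|\varphi(\theta)\|$. Let $BUC_\eta^1$ be the space of $C^1$ functions $\varphi$ with $\varphi,\varphi'\in BUC_\eta$. Let $X=\mathbb R^n\times BUC_\eta$ with norm $\|(\alpha,\varphi)\|=\|\alpha\|+\|\varphi\|_\eta$, let $A(0,\varphi)=(-\varphi'(0),\varphi')$ with domain $D(A)=\{0\}\times BUC_\eta^1$, and put $X_0=\overline{D(A)}$ $(=\{0\}\times BUC_\eta)$. Let $f:BUC_\eta\to\mathbb R^n$ be Lipschitz on bounded sets, and let $F(0,\varphi)=(f(\varphi),0)$. For $x\in X_0$, a mild solution on $[0,\tau]$ of $v'=Av+F(v)$, $v(0)=x$, is a continuous $v:[0,\tau]\to X_0$ such that, for all $t\in[0,\tau]$, $\int_0^t v(s)\,ds\in D(A)$ and $$v(t)=x+A\int_0^t v(s)\,ds+\int_0^t F(v(s))\,ds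 .$$ Let $\chi(x)\in[0,\infty]$ be the supremum of the $\tau\ge 0$ for which a mild solution on $[0,\tau]$ exists, and let $U(t)x$ denote the value at time $t$ of the mild solution starting at $x$. Assume that $f(0)=0$ and that $f$ is continuously differentiable in a neighbourhood of $0$. Let $\widehat L=Df(0)$, extended to $\mathbb C^n$-valued functions by $\widehat L(\varphi+i\psi)=\widehat L\varphi+i\widehat L\psi$, and for $\lambda\in\mathbb C$ with $\operatorname{Re}\lambda>-\eta$ let $\Delta(\lambda)=\lambda I-\widehat L(e^{\lambda\cdot}I)\in M_n(\mathbb C)$, that is, the $j$-th column of $\widehat L(e^{\lambda\cdot}I)$ is $\widehat L(\theta\mapsto e^{\lambda\theta}e_j)$. Assume that for every $\lambda\in\mathbb C$ with $\operatorname{Re}\lambda>-\eta$, $$\det\Delta(\lambda)=0\ \Longrightarrow\ \operatorname{Re}\lambda<0 .$$ Then the equilibrium $0$ is asymptotically stable for $U$ on $X_0$ (it is Lyapunov stable, and there is a neighbourhood of $0$ in $X_0$ all of whose points $x$ satisfy $\chi(x)=\infty$ and $U(t)x\to 0$ as $t\to\infty$). More precisely, there are constants $M\ge 1$, $\delta>0$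 and $\varepsilon>0$ such that for every $x\in X_0$ with $\|x\|\le\varepsilon$ one has $\chi(x)=\infty$, $t\mapsto U(t)x$ is on each interval $[0,\tau]$, $\tau\ge 0$, the unique mild solution starting at $x$, and $$\|U(t)x\|\le M e^{-\delta t}\|x\|\qquad\text{for all } t\ge 0 .$$ -/

import Mathlib

open scoped NNReal ENNReal

noncomputable section

namespace InfiniteDelay

/-! ### The weighted space `BUC_η` -/

/-- The functions `φ : (-∞, 0] → E` that are continuous and for which `θ ↦ e^{ηθ} φ(θ)` is bounded
and uniformly continuous, as a linear subspace of all functions. -/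
def bucSubmodule (η : ℝ) (E : Type*) [NormedAddCommGroup E] [NormedSpace ℝ E] :
    Submodule ℝ (Set.Iic (0 : ℝ) → E) where
  carrier := {φ | Continuous φ ∧
    (∃ C : ℝ, ∀ θ : Set.Iic (0 : ℝ), ‖Real.exp (η * θ) • φ θ‖ ≤ C) ∧
    UniformContinuous (fun θ : Set.Iic (0 : ℝ) => Real.exp (η * θ) • φ θ)}
  zero_mem' := by
    refine ⟨continuous_const, ⟨0, fun θ => by simp⟩, ?_⟩
    simpa using uniformContinuous_const
  add_mem' := by
    rintro φ ψ ⟨h1, ⟨C, hC⟩, h2⟩ ⟨k1, ⟨D, hD⟩, k2⟩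
    refine ⟨h1.add k1, ⟨C + D, fun θ => ?_⟩, ?_⟩
    · rw [Pi.add_apply, smul_add]
      exact (norm_add_le _ _).trans (add_le_add (hC θ) (hD θ))
    · simpa only [Pi.add_apply, smul_add] using h2.add k2
  smul_mem' := by
    rintro c φ ⟨h1, ⟨C, hC⟩, h2⟩
    refine ⟨h1.const_smul c, ⟨‖c‖ * C, fun θ => ?_⟩, ?_⟩
    · rw [Pi.smul_apply, smul_comm, norm_smul]
      exact mul_le_mul_of_nonneg_left (hC θ) (norm_nonneg _)
    · have h : (fun θ : Set.Iic (0 : ℝ) => Real.exp (η * θ) • (c • φ) θ)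
          = c • fun θ : Set.Iic (0 : ℝ) => Real.exp (η * θ) • φ θ :=
        funext fun θ => smul_comm _ _ _
      rw [h]
      exact h2.const_smul c

/-- The space `BUC_η((-∞, 0], E)`. -/
def BUC (η : ℝ) (E : Type*) [NormedAddCommGroup E] [NormedSpace ℝ E] : Type _ :=
  bucSubmodule η E

namespace BUC

variable {η : ℝ} {E : Type*} [NormedAddCommGroup E] [NormedSpace ℝ E]

instance : AddCommGroup (BUC η E) := inferInstanceAs (AddCommGroup (bucSubmodule η E))

instance : Module ℝ (BUC η E) := inferInstanceAs (Module ℝ (bucSubmodule η E))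

instance : FunLike (BUC η E) (Set.Iic (0 : ℝ)) E where
  coe φ := φ.1
  coe_injective := Subtype.val_injective

@[simp] theorem coe_zero : ⇑(0 : BUC η E) = 0 := rfl
@[simp] theorem coe_add (φ ψ : BUC η E) : ⇑(φ + ψ) = φ + ψ := rfl
@[simp] theorem coe_sub (φ ψ : BUC η E) : ⇑(φ - ψ) = φ - ψ := rfl
@[simp] theorem coe_smul (c : ℝ) (φ : BUC η E) : ⇑(c • φ) = c • ⇑φ := rfl

theorem mem (φ : BUC η E) : ⇑φ ∈ bucSubmodule η E := φ.2

/-- A function in the subspace, as an element of `BUC_η`. -/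
def mk (φ : Set.Iic (0 : ℝ) → E) (h : φ ∈ bucSubmodule η E) : BUC η E := ⟨φ, h⟩

@[simp] theorem coe_mk (φ : Set.Iic (0 : ℝ) → E) (h : φ ∈ bucSubmodule η E) :
    ⇑(mk φ h) = φ := rfl

/-- `‖φ‖_η = sup_{θ ≤ 0} e^{ηθ} ‖φ(θ)‖`. -/
instance : Norm (BUC η E) where
  norm φ := ⨆ θ : Set.Iic (0 : ℝ), Real.exp (η * θ) * ‖φ θ‖

theorem norm_def (φ : BUC η E) :
    ‖φ‖ = ⨆ θ : Set.Iic (0 : ℝ), Real.exp (η * θ) * ‖φ θ‖ := rfl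

theorem norm_weight (t : ℝ) (v : E) : ‖Real.exp t • v‖ = Real.exp t * ‖v‖ := by
  rw [norm_smul, Real.norm_eq_abs, Real.abs_exp]

theorem bddAbove (φ : BUC η E) :
    BddAbove (Set.range fun θ : Set.Iic (0 : ℝ) => Real.exp (η * θ) * ‖φ θ‖) := by
  obtain ⟨-, ⟨C, hC⟩, -⟩ := φ.mem
  refine ⟨C, ?_⟩
  rintro _ ⟨θ, rfl⟩
  simpa only [norm_weight] using hC θ

theorem weight_le_norm (φ : BUC η E) (θ : Set.Iic (0 : ℝ)) :
    Real.exp (η * θ) * ‖φ θ‖ ≤ ‖φ‖ := le_ciSup φ.bddAbove θ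

instance : Nonempty (Set.Iic (0 : ℝ)) := ⟨⟨0, Set.self_mem_Iic⟩⟩

theorem norm_le (φ : BUC η E) {C : ℝ} (h : ∀ θ : Set.Iic (0 : ℝ), Real.exp (η * θ) * ‖φ θ‖ ≤ C) :
    ‖φ‖ ≤ C := ciSup_le h

theorem core : NormedSpace.Core ℝ (BUC η E) where
  norm_nonneg φ := Real.iSup_nonneg fun θ => by positivity
  norm_smul c φ := by
    rw [norm_def, norm_def, Real.mul_iSup_of_nonneg (norm_nonneg c)]
    congr 1
    funext θ
    rw [coe_smul, Pi.smul_apply, norm_smul]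
    ring
  norm_triangle φ ψ := by
    refine norm_le _ fun θ => ?_
    calc Real.exp (η * θ) * ‖(φ + ψ) θ‖
        ≤ Real.exp (η * θ) * (‖φ θ‖ + ‖ψ θ‖) :=
          mul_le_mul_of_nonneg_left (norm_add_le _ _) (Real.exp_pos _).le
      _ = Real.exp (η * θ) * ‖φ θ‖ + Real.exp (η * θ) * ‖ψ θ‖ := mul_add _ _ _
      _ ≤ ‖φ‖ + ‖ψ‖ := add_le_add (weight_le_norm φ θ) (weight_le_norm ψ θ)
  norm_eq_zero_iff φ := by
    constructor
    · intro h
      refine DFunLike.ext _ _ fun θ => ?_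
      have h1 := weight_le_norm φ θ
      rw [h] at h1
      have h2 : ‖φ θ‖ ≤ 0 := by
        by_contra! h3
        exact absurd (mul_pos (Real.exp_pos (η * θ)) h3) (not_lt.mpr h1)
      simpa using h2
    · rintro rfl
      simp [norm_def]

instance : NormedAddCommGroup (BUC η E) := NormedAddCommGroup.ofCore core

instance : NormedSpace ℝ (BUC η E) := NormedSpace.ofCore core

/-- The weighted function `θ ↦ e^{ηθ} φ(θ)` as a bounded continuous function. -/
def weighted (φ : BUC η E) : BoundedContinuousFunction (Set.Iic (0 : ℝ)) E :=
  BoundedContinuousFunction.ofNormedAddCommGroup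
    (fun θ : Set.Iic (0 : ℝ) => Real.exp (η * θ) • φ θ) φ.mem.2.2.continuous ‖φ‖
    (fun θ => by rw [norm_weight]; exact weight_le_norm φ θ)

theorem weighted_isometry : Isometry (weighted : BUC η E → _) := by
  refine Isometry.of_dist_eq fun φ ψ => ?_
  rw [dist_eq_norm, dist_eq_norm, BoundedContinuousFunction.norm_eq_iSup_norm, norm_def]
  congr 1
  funext θ
  change ‖Real.exp (η * θ) • φ θ - Real.exp (η * θ) • ψ θ‖ = _
  rw [← smul_sub, norm_weight]
  rfl

theorem range_weighted : Set.range (weighted : BUC η E → _) =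
    {g : BoundedContinuousFunction (Set.Iic (0 : ℝ)) E | UniformContinuous g} := by
  ext g
  constructor
  · rintro ⟨φ, rfl⟩
    exact φ.mem.2.2
  · intro hg
    have key : ∀ θ : Set.Iic (0 : ℝ), Real.exp (η * θ) • Real.exp (-(η * θ)) • g θ = g θ := by
      intro θ
      rw [smul_smul, ← Real.exp_add]
      simp
    refine ⟨mk (fun θ => Real.exp (-(η * θ)) • g θ) ⟨by fun_prop, ⟨‖g‖, fun θ => ?_⟩, ?_⟩, ?_⟩
    · rw [key]; exact g.norm_coe_le_norm θ
    · simp only [key]; exact hg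
    · ext1 θ; exact key θ

instance [CompleteSpace E] : CompleteSpace (BUC η E) := by
  rw [completeSpace_iff_isComplete_range weighted_isometry.isUniformInducing, range_weighted]
  refine IsClosed.isComplete ?_
  refine isClosed_of_closure_subset fun g hg => ?_
  obtain ⟨u, hu, hlim⟩ := mem_closure_iff_seq_limit.mp hg
  exact (BoundedContinuousFunction.tendsto_iff_tendstoUniformly.mp hlim).uniformContinuous
    (Filter.Eventually.of_forall hu).frequently

/-- The endpoint `0` of `(-∞, 0]`. -/
def endpoint : Set.Iic (0 : ℝ) := ⟨0, Set.self_mem_Iic⟩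

/-- The derivative of a function on `(-∞, 0]` (one-sided at the endpoint `0`). -/
def derivIic (φ : Set.Iic (0 : ℝ) → E) : Set.Iic (0 : ℝ) → E :=
  fun θ => derivWithin (Set.IicExtend φ) (Set.Iic 0) θ

variable (η E) in
/-- The subspace `BUC_η^1` of the `C^1` functions `φ` with `φ, φ' ∈ BUC_η`; the continuity of `φ'`
is part of `φ' ∈ BUC_η`. -/
def C1 : Submodule ℝ (BUC η E) where
  carrier := {φ | DifferentiableOn ℝ (Set.IicExtend φ) (Set.Iic 0) ∧
    derivIic φ ∈ bucSubmodule η E}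
  zero_mem' := by
    have h : Set.IicExtend (⇑(0 : BUC η E)) = fun _ => 0 := rfl
    refine ⟨by rw [h]; exact differentiableOn_const _, ?_⟩
    have h' : derivIic (⇑(0 : BUC η E)) = 0 := by
      funext θ
      rw [derivIic, h]
      simp
    rw [h']
    exact Submodule.zero_mem _
  add_mem' := by
    rintro φ ψ ⟨h1, h2⟩ ⟨k1, k2⟩
    have h : Set.IicExtend (⇑(φ + ψ)) = Set.IicExtend φ + Set.IicExtend ψ := rfl
    refine ⟨by rw [h]; exact h1.add k1, ?_⟩
    have h' : derivIic (⇑(φ + ψ)) = derivIic φ + derivIic ψ := by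
      funext θ
      rw [derivIic, h]
      exact derivWithin_add (h1 θ θ.2) (k1 θ θ.2)
    rw [h']
    exact Submodule.add_mem _ h2 k2
  smul_mem' := by
    rintro c φ ⟨h1, h2⟩
    have h : Set.IicExtend (⇑(c • φ)) = c • Set.IicExtend φ := rfl
    refine ⟨by rw [h]; exact h1.const_smul c, ?_⟩
    have h' : derivIic (⇑(c • φ)) = c • derivIic φ := by
      funext θ
      rw [derivIic, h]
      exact derivWithin_const_smul c (h1 θ θ.2)
    rw [h']
    exact Submodule.smul_mem _ c h2

/-- The derivative `φ ↦ φ'` as a linear map `BUC_η^1 → BUC_η`. -/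
def derivL : C1 η E →ₗ[ℝ] BUC η E where
  toFun φ := mk (derivIic φ.1) φ.2.2
  map_add' φ ψ := DFunLike.ext _ _ fun θ =>
    derivWithin_add (φ.2.1 θ θ.2) (ψ.2.1 θ θ.2)
  map_smul' c φ := DFunLike.ext _ _ fun θ =>
    derivWithin_const_smul c (φ.2.1 θ θ.2)

/-- The function `θ ↦ e^{zθ} v` on `(-∞, 0]`, an element of `BUC_η(ℂⁿ)` when `-η < Re z`. -/
def expFun {n : ℕ} (z : ℂ) (hz : -η < z.re) (v : EuclideanSpace ℂ (Fin n)) :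
    BUC η (EuclideanSpace ℂ (Fin n)) :=
  mk (fun θ => Complex.exp (z * (θ : ℝ)) • v) <| by
    have key : ∀ t : ℝ, Real.exp (η * t) • Complex.exp (z * t) • v
        = Complex.exp ((η + z) * t) • v := by
      intro t
      rw [← Complex.coe_smul (Real.exp (η * t)), smul_smul, Complex.ofReal_exp,
        ← Complex.exp_add]
      congr 2
      push_cast
      ring
    have hle : ∀ t : ℝ, t ≤ 0 → ‖Complex.exp ((η + z) * t)‖ ≤ 1 := by
      intro t ht
      rw [Complex.norm_exp, Real.exp_le_one_iff]
      have h : ((η + z) * (t : ℂ)).re = (η + z.re) * t := by simp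
      rw [h]
      exact mul_nonpos_of_nonneg_of_nonpos (by linarith) ht
    refine ⟨by fun_prop, ⟨‖v‖, fun θ => ?_⟩, ?_⟩
    · rw [key, norm_smul]
      exact mul_le_of_le_one_left (norm_nonneg v) (hle θ θ.2)
    · simp only [key]
      have hlip : LipschitzOnWith (‖(η : ℂ) + z‖₊ * ‖v‖₊)
          (fun t : ℝ => Complex.exp ((η + z) * t) • v) (Set.Iic 0) := by
        refine Convex.lipschitzOnWith_of_nnnorm_hasDerivWithin_le (𝕜 := ℝ)
          (f' := fun t : ℝ => (Complex.exp ((η + z) * t) * (η + z)) • v) (convex_Iic 0) ?_ ?_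
        · intro t _
          have h1 : HasDerivAt (fun t : ℝ => ((η : ℂ) + z) * t) ((η : ℂ) + z) t := by
            simpa using (Complex.ofRealCLM.hasDerivAt (x := t)).const_mul ((η : ℂ) + z)
          exact (h1.cexp.smul_const v).hasDerivWithinAt
        · intro t ht
          rw [nnnorm_smul, nnnorm_mul]
          have h1 : ‖Complex.exp ((η + z) * t)‖₊ ≤ 1 := hle t ht
          gcongr
          exact mul_le_of_le_one_left (by positivity) h1
      exact (lipschitzOnWith_iff_restrict.mp hlip).uniformContinuous

/-- Composition of an element of `BUC_η(E)` with a bounded linear map. -/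
def comp {F : Type*} [NormedAddCommGroup F] [NormedSpace ℝ F] (T : E →L[ℝ] F) (φ : BUC η E) :
    BUC η F :=
  mk (fun θ => T (φ θ)) <| by
    obtain ⟨h1, ⟨C, hC⟩, h2⟩ := φ.mem
    refine ⟨T.continuous.comp h1, ⟨‖T‖ * C, fun θ => ?_⟩, ?_⟩
    · rw [← T.map_smul]
      exact (T.le_opNorm _).trans (mul_le_mul_of_nonneg_left (hC θ) (norm_nonneg _))
    · simp only [← T.map_smul]
      exact T.uniformContinuous.comp h2

end BUC

/-! ### The characteristic matrix -/

/-- Coordinatewise real part `ℂⁿ → ℝⁿ`. -/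
def reL (n : ℕ) : EuclideanSpace ℂ (Fin n) →L[ℝ] EuclideanSpace ℝ (Fin n) :=
  LinearMap.toContinuousLinearMap
    { toFun := fun v => WithLp.toLp 2 fun i => (v i).re
      map_add' := fun v w => by ext i; simp
      map_smul' := fun c v => by ext i; simp }

/-- Coordinatewise imaginary part `ℂⁿ → ℝⁿ`. -/
def imL (n : ℕ) : EuclideanSpace ℂ (Fin n) →L[ℝ] EuclideanSpace ℝ (Fin n) :=
  LinearMap.toContinuousLinearMap
    { toFun := fun v => WithLp.toLp 2 fun i => (v i).im
      map_add' := fun v w => by ext i; simp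
      map_smul' := fun c v => by ext i; simp }

variable {n : ℕ} {η : ℝ}

/-- The complexification of `Lhat : BUC_η(ℝⁿ) → ℝⁿ`,
`Lhat(φ + iψ) = Lhat(φ) + i Lhat(ψ)`, given in coordinates. -/
def complexify (Lhat : BUC η (EuclideanSpace ℝ (Fin n)) →L[ℝ] EuclideanSpace ℝ (Fin n))
    (φ : BUC η (EuclideanSpace ℂ (Fin n))) (i : Fin n) : ℂ :=
  (Lhat (φ.comp (reL n)) i : ℂ) + Complex.I * (Lhat (φ.comp (imL n)) i : ℂ)

/-- The characteristic matrix `Δ(z) = z I - Lhat(e^{z·} I) ∈ M_n(ℂ)` for `Re z > -η`: the `j`-th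
column of `Lhat(e^{z·} I)` is the (complexified) value of `Lhat` at `θ ↦ e^{zθ} e_j`. -/
def charMatrix (Lhat : BUC η (EuclideanSpace ℝ (Fin n)) →L[ℝ] EuclideanSpace ℝ (Fin n))
    (z : ℂ) (hz : -η < z.re) : Matrix (Fin n) (Fin n) ℂ :=
  z • (1 : Matrix (Fin n) (Fin n) ℂ) -
    Matrix.of fun i j => complexify Lhat (BUC.expFun z hz (EuclideanSpace.single j 1)) i

/-! ### The abstract Cauchy problem and its semiflow -/

variable (n η) in
/-- `X = ℝⁿ × BUC_η` with the norm `‖(α, φ)‖ = ‖α‖ + ‖φ‖_η`. -/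
abbrev X : Type :=
  WithLp 1 (EuclideanSpace ℝ (Fin n) × BUC η (EuclideanSpace ℝ (Fin n)))

variable (n η) in
/-- The domain `{0} × BUC_η^1`. -/
def domA : Submodule ℝ (X n η) where
  carrier := {x | x.fst = 0 ∧ x.snd ∈ BUC.C1 η (EuclideanSpace ℝ (Fin n))}
  zero_mem' := ⟨rfl, Submodule.zero_mem _⟩
  add_mem' := fun {x y} hx hy => by
    refine ⟨?_, Submodule.add_mem _ hx.2 hy.2⟩
    rw [WithLp.add_fst, hx.1, hy.1, add_zero]
  smul_mem' := fun c x hx => by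
    refine ⟨?_, Submodule.smul_mem _ c hx.2⟩
    rw [WithLp.smul_fst, hx.1, smul_zero]

variable (n η) in
/-- The second component of an element of the domain, as an element of `BUC_η^1`. -/
def sndC1 : domA n η →ₗ[ℝ] BUC.C1 η (EuclideanSpace ℝ (Fin n)) where
  toFun x := ⟨x.1.snd, x.2.2⟩
  map_add' _ _ := rfl
  map_smul' _ _ := rfl

variable (n η) in
/-- The unbounded operator `A (0, φ) = (-φ'(0), φ')` in `X` with domain `{0} × BUC_η^1`. -/
def A : X n η →ₗ.[ℝ] X n η where
  domain := domA n η
  toFun :=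
    { toFun := fun x =>
        WithLp.toLp 1 (-(BUC.derivL (sndC1 n η x) BUC.endpoint), BUC.derivL (sndC1 n η x))
      map_add' := fun x y => by
        rw [map_add, map_add, ← WithLp.toLp_add, Prod.mk_add_mk, BUC.coe_add, Pi.add_apply,
          neg_add]
      map_smul' := fun c x => by
        rw [map_smul, map_smul, RingHom.id_apply, ← WithLp.toLp_smul, Prod.smul_mk, BUC.coe_smul,
          Pi.smul_apply, smul_neg] }

variable (n η) in
/-- `X₀`, the closure of the domain of `A`. -/
def X₀ : Set (X n η) := closure ((A n η).domain : Set (X n η))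

/-- The nonlinearity `F (0, φ) = (f(φ), 0)`; only its values on `X₀` are used. -/
def F (f : BUC η (EuclideanSpace ℝ (Fin n)) → EuclideanSpace ℝ (Fin n)) (x : X n η) : X n η :=
  WithLp.toLp 1 (f x.snd, 0)

/-- `v` is, on `[0, τ]`, a mild (integrated) solution of `dv/dt = A v + F(v)`, `v(0) = x`: it is
continuous with values in `X₀`, `∫₀ᵗ v(s) ds ∈ D(A)` and
`v(t) = x + A ∫₀ᵗ v(s) ds + ∫₀ᵗ F(v(s)) ds` for `0 ≤ t ≤ τ`. -/
structure IsMildSolution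
    (f : BUC η (EuclideanSpace ℝ (Fin n)) → EuclideanSpace ℝ (Fin n))
    (x : X n η) (τ : ℝ) (v : ℝ → X n η) : Prop where
  continuousOn : ContinuousOn v (Set.Icc 0 τ)
  mem : ∀ t ∈ Set.Icc 0 τ, v t ∈ X₀ n η
  eq : ∀ t ∈ Set.Icc 0 τ, ∃ h : (∫ s in (0 : ℝ)..t, v s) ∈ (A n η).domain,
    v t = x + A n η ⟨∫ s in (0 : ℝ)..t, v s, h⟩ + ∫ s in (0 : ℝ)..t, F f (v s)

/-- The maximal existence time `χ(x) ∈ [0, ∞]` of mild solutions starting at `x`. -/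
def χ (f : BUC η (EuclideanSpace ℝ (Fin n)) → EuclideanSpace ℝ (Fin n)) (x : X n η) : ℝ≥0∞ :=
  ⨆ (τ : ℝ≥0) (_ : ∃ v, IsMildSolution f x τ v), (τ : ℝ≥0∞)

open Classical in
/-- The semiflow: `U(t)x` is the value at time `t` of the mild solution starting at `x`
(and `0` if there is no mild solution on `[0, t]`). -/
def U (f : BUC η (EuclideanSpace ℝ (Fin n)) → EuclideanSpace ℝ (Fin n)) (t : ℝ) (x : X n η) :
    X n η :=
  if h : ∃ v, IsMildSolution f x t v then h.choose t else 0

/-- `f` is Lipschitz on bounded sets. -/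
def LipschitzOnBounded
    (f : BUC η (EuclideanSpace ℝ (Fin n)) → EuclideanSpace ℝ (Fin n)) : Prop :=
  ∀ ξ : ℝ, 0 < ξ → ∃ κ : ℝ, ∀ φ ψ : BUC η (EuclideanSpace ℝ (Fin n)),
    ‖φ‖ ≤ ξ → ‖ψ‖ ≤ ξ → ‖f φ - f ψ‖ ≤ κ * ‖φ - ψ‖

/-- The equilibrium `0` is asymptotically stable for the semiflow `U` on `X₀`: it is stable, and
it attracts all points of some neighbourhood of `0` in `X₀`. -/
def ZeroAsymptoticallyStable
    (f : BUC η (EuclideanSpace ℝ (Fin n)) → EuclideanSpace ℝ (Fin n)) : Prop :=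
  (∀ ε : ℝ, 0 < ε → ∃ r : ℝ, 0 < r ∧ ∀ x ∈ X₀ n η, ‖x‖ ≤ r →
    χ f x = ⊤ ∧ ∀ t : ℝ, 0 ≤ t → ‖U f t x‖ ≤ ε) ∧
  ∃ r : ℝ, 0 < r ∧ ∀ x ∈ X₀ n η, ‖x‖ ≤ r →
    χ f x = ⊤ ∧ Filter.Tendsto (fun t : ℝ => U f t x) Filter.atTop (nhds 0)

end InfiniteDelay

end

open scoped NNReal ENNReal

noncomputable section

namespace InfiniteDelay

open Set Filter Topology MeasureTheory

variable {η : ℝ} {E : Type*} [NormedAddCommGroup E] [NormedSpace ℝ E]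

/-! The abstract problem is the delay equation `u'(t) = f(u_t)` in disguise. For a mild solution
`(0, v(t))`, the second component of the integrated equation says that `v` is transported along the
lines `t + θ = const`, and the first component says that the boundary value `v(t)(0)` moves with
velocity `f(v(t))`. Integration along characteristics shows that `v(t)` is the history `u_t` of a
single function `u`, and conversely (`isMildSolution_iff`). After this reduction `A` plays no
further role, and existence and uniqueness come from a weighted Picard iteration and Grönwall's
inequality.

For the linear equation `u' = L u_t`, complexified, let `T(t)` be the solution operators. The
time-one map splits as `T(1) = S + K`. The operator `S` shifts the past and continues it by
exponential decay, so that its norm is at most `e^{-η} < 1`. The operator `K` is compact by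
Arzelà–Ascoli, since solutions have bounded derivative on `[0, 1]`
(`isCompactOperator_semigroup_one_sub`). Hence every spectral value `μ` of `T(1)` with `|μ| ≥ 1` is
an eigenvalue (`exists_eigenvector_of_mem_spectrum`). If `T(1)φ = μφ`, then `s ↦ μ^{-s} T(s)φ` is
1-periodic, and a nonzero Fourier coefficient `c` of it satisfies `T(t)c = e^{zt}c` with `e^z = μ`,
hence `Re z ≥ 0` (`exists_eigenfunction`). Such a `c` is an exponential function and its value at
`0` lies in the kernel of `Δ(z)` (`det_charMatrix_eq_zero`), contrary to the hypothesis. So the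
spectral radius of `T(1)` is below 1, and `‖T(m)‖ ≤ 1/4` for some `m`.

For the nonlinear equation, `f` is replaced by a globally Lipschitz `g` that equals `f` near `0` and
is uniformly close to `Df(0)` (`exists_truncation`). By Grönwall, the flow of `g` at time `m`
differs from `T(m)` by at most `1/4` of the norm of the initial value, so it halves norms, and
iteration gives exponential decay. Small solutions of the `g`-equation never leave the ball where `g
= f`, and therefore solve the original equation. -/

/-! ### Histories of continuous functions -/

/-- The point `min r 0` of `(-∞, 0]`. -/
def clip (r : ℝ) : Iic (0 : ℝ) := ⟨min r 0, min_le_right r 0⟩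

theorem clip_of_nonpos {r : ℝ} (h : r ≤ 0) : clip r = ⟨r, h⟩ := Subtype.ext (min_eq_left h)

theorem clip_coe (θ : Iic (0 : ℝ)) : clip θ = θ := clip_of_nonpos θ.2

theorem clip_of_nonneg {r : ℝ} (h : 0 ≤ r) : clip r = BUC.endpoint := Subtype.ext (min_eq_right h)

theorem lipschitzWith_clip : LipschitzWith 1 clip :=
  LipschitzWith.subtype_mk (LipschitzWith.id.min_const 0) _

theorem continuous_clip : Continuous clip := lipschitzWith_clip.continuous

namespace BUC

theorem norm_apply_le (φ : BUC η E) (θ : Iic (0 : ℝ)) : ‖φ θ‖ ≤ Real.exp (-(η * θ)) * ‖φ‖ := by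
  have h := weight_le_norm φ θ
  calc ‖φ θ‖ = Real.exp (-(η * θ)) * (Real.exp (η * θ) * ‖φ θ‖) := by
        rw [← mul_assoc, ← Real.exp_add]; simp
    _ ≤ _ := by gcongr

theorem norm_endpoint_le (φ : BUC η E) : ‖φ endpoint‖ ≤ ‖φ‖ := by
  simpa [endpoint] using norm_apply_le φ endpoint

variable (η E) in
/-- Evaluation at a point of `(-∞, 0]`. -/
def evalL (θ : Iic (0 : ℝ)) : BUC η E →L[ℝ] E :=
  LinearMap.mkContinuous
    { toFun := fun φ => φ θ
      map_add' := fun _ _ => rfl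
      map_smul' := fun _ _ => rfl } (Real.exp (-(η * θ))) fun φ => norm_apply_le φ θ

end BUC

/-- The weighted function, frozen after time `T`. -/
def weightedUpTo (η : ℝ) (T : ℝ) (u : ℝ → E) (r : ℝ) : E :=
  Real.exp (η * min r T) • u (min r T)

/-- The function is the sum of its restriction to the past, uniformly continuous by membership in
`BUC_η`, and its restriction to the compact interval `[0, T]`, each frozen outside its range, minus
the common value `u 0`. -/
theorem uniformContinuous_weightedUpTo {u : ℝ → E} (hu : Continuous u)
    (h0 : (fun θ : Iic (0 : ℝ) => u θ) ∈ bucSubmodule η E) {T : ℝ} (hT : 0 ≤ T) :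
    UniformContinuous (weightedUpTo η T u) := by
  have h1 : UniformContinuous fun r : ℝ => Real.exp (η * min r 0) • u (min r 0) :=
    h0.2.2.comp lipschitzWith_clip.uniformContinuous
  have h2 : UniformContinuous fun r : ℝ =>
      Real.exp (η * projIcc 0 T hT r) • u (projIcc 0 T hT r) := by
    have : UniformContinuous fun r : Icc (0 : ℝ) T => Real.exp (η * r) • u r :=
      CompactSpace.uniformContinuous_of_continuous (by fun_prop)
    exact this.comp (LipschitzWith.projIcc hT).uniformContinuous
  have h3 : weightedUpTo η T u = fun r => Real.exp (η * min r 0) • u (min r 0) +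
      Real.exp (η * projIcc 0 T hT r) • u (projIcc 0 T hT r) - u 0 := by
    funext r
    rcases le_total r 0 with hr | hr
    · rw [projIcc_of_le_left hT hr, weightedUpTo, min_eq_left hr, min_eq_left (hr.trans hT)]
      simp
    · rw [min_eq_right hr]
      rcases le_total r T with h | h
      · rw [projIcc_of_mem hT ⟨hr, h⟩, weightedUpTo, min_eq_left h]
        simp
      · rw [projIcc_of_right_le hT h, weightedUpTo, min_eq_right h]
        simp
  rw [h3]
  exact (h1.add h2).sub uniformContinuous_const

theorem exists_bound_weightedUpTo {u : ℝ → E} (hu : Continuous u)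
    (h0 : (fun θ : Iic (0 : ℝ) => u θ) ∈ bucSubmodule η E) (T : ℝ) :
    ∃ C, ∀ r, ‖weightedUpTo η T u r‖ ≤ C := by
  obtain ⟨C, hC⟩ := h0.2.1
  have hcont : Continuous fun r => ‖Real.exp (η * r) • u r‖ := by fun_prop
  obtain ⟨D, hD⟩ := (isCompact_Icc (a := (0 : ℝ)) (b := T)).bddAbove_image hcont.continuousOn
  refine ⟨max C D, fun r => ?_⟩
  rcases le_total (min r T) 0 with h | h
  · exact (hC ⟨min r T, h⟩).trans (le_max_left _ _)
  · exact (hD ⟨min r T, ⟨h, min_le_right _ _⟩, rfl⟩).trans (le_max_right _ _)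

/-- Shifting by `t` only multiplies the weight by `e^{-ηt}`. All weighted histories up to time `T`
are thus multiples of translates of one uniformly continuous function. -/
theorem exp_smul_shift (η t : ℝ) (u : ℝ → E) {T θ : ℝ} (h : t + θ ≤ T) :
    Real.exp (η * θ) • u (t + θ) = Real.exp (-(η * t)) • weightedUpTo η T u (t + θ) := by
  rw [weightedUpTo, min_eq_left h, smul_smul, ← Real.exp_add]
  congr 2
  ring

theorem shift_mem {u : ℝ → E} (hu : Continuous u)
    (h0 : (fun θ : Iic (0 : ℝ) => u θ) ∈ bucSubmodule η E) (t : ℝ) :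
    (fun θ : Iic (0 : ℝ) => u (t + θ)) ∈ bucSubmodule η E := by
  obtain ⟨C, hC⟩ := exists_bound_weightedUpTo hu h0 |t|
  have key : ∀ θ : Iic (0 : ℝ), t + θ ≤ |t| := fun θ => by
    have h1 : (θ : ℝ) ≤ 0 := θ.2
    linarith [le_abs_self t]
  refine ⟨by fun_prop, ⟨Real.exp (-(η * t)) * C, fun θ => ?_⟩, ?_⟩
  · rw [exp_smul_shift η t u (key θ), BUC.norm_weight]
    exact mul_le_mul_of_nonneg_left (hC _) (Real.exp_pos _).le
  · simp only [exp_smul_shift η t u (key _)]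
    refine UniformContinuous.const_smul ?_ _
    exact (uniformContinuous_weightedUpTo hu h0 (abs_nonneg t)).comp
      (uniformContinuous_const.add uniformContinuous_subtype_val)

/-- The history `θ ↦ u (t + θ)` of a continuous function `u` at time `t`. -/
def history (u : ℝ → E) (hu : Continuous u)
    (h0 : (fun θ : Iic (0 : ℝ) => u θ) ∈ bucSubmodule η E) (t : ℝ) : BUC η E :=
  BUC.mk (fun θ => u (t + θ)) (shift_mem hu h0 t)

@[simp] theorem history_apply {u : ℝ → E} (hu : Continuous u)
    (h0 : (fun θ : Iic (0 : ℝ) => u θ) ∈ bucSubmodule η E) (t : ℝ) (θ : Iic (0 : ℝ)) :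
    history u hu h0 t θ = u (t + θ) := rfl

/-- Translation is continuous in the supremum norm exactly on uniformly continuous functions. The
increment splits into the change of the factor `e^{-ηt}`, times a bound, and a translation increment
of the fixed function `weightedUpTo`. -/
theorem continuous_history {u : ℝ → E} (hu : Continuous u)
    (h0 : (fun θ : Iic (0 : ℝ) => u θ) ∈ bucSubmodule η E) : Continuous (history u hu h0) := by
  rw [continuous_iff_continuousAt]
  intro t
  obtain ⟨C, hC⟩ := exists_bound_weightedUpTo hu h0 (|t| + 1)
  have hUC := uniformContinuous_weightedUpTo hu h0 (T := |t| + 1) (by positivity)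
  set G := weightedUpTo η (|t| + 1) u
  rw [ContinuousAt, Metric.tendsto_nhds]
  intro ε hε
  obtain ⟨δ, hδ, hG⟩ := Metric.uniformContinuous_iff.mp hUC
    (ε / (4 * Real.exp (-(η * t)))) (by positivity)
  have e1 : Tendsto (fun s : ℝ => Real.exp (-(η * s))) (𝓝 t) (𝓝 (Real.exp (-(η * t)))) :=
    (by fun_prop : Continuous fun s : ℝ => Real.exp (-(η * s))).tendsto t
  have e2 : Tendsto (fun s : ℝ => |Real.exp (-(η * s)) - Real.exp (-(η * t))| * C) (𝓝 t) (𝓝 0) := by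
    have : Continuous fun s : ℝ => |Real.exp (-(η * s)) - Real.exp (-(η * t))| * C := by fun_prop
    simpa using this.tendsto t
  filter_upwards [e2.eventually_lt_const (by positivity : 0 < ε / 2), Metric.ball_mem_nhds t hδ,
    Metric.ball_mem_nhds t one_pos] with s hs hsδ hs1
  rw [dist_eq_norm]
  have hst : s ≤ |t| + 1 := by
    rw [Metric.mem_ball, Real.dist_eq] at hs1
    linarith [le_abs_self t, le_abs_self (s - t)]
  have : ‖history u hu h0 s - history u hu h0 t‖ ≤ ε / 2 + ε / 4 := by
    refine BUC.norm_le _ fun θ => ?_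
    have hθ : (θ : ℝ) ≤ 0 := θ.2
    rw [← BUC.norm_weight, BUC.coe_sub, Pi.sub_apply, history_apply, history_apply, smul_sub,
      exp_smul_shift η s u (by linarith : s + θ ≤ |t| + 1),
      exp_smul_shift η t u (by linarith [le_abs_self t] : t + θ ≤ |t| + 1)]
    change ‖Real.exp (-(η * s)) • G (s + θ) - Real.exp (-(η * t)) • G (t + θ)‖ ≤ _
    have : Real.exp (-(η * s)) • G (s + θ) - Real.exp (-(η * t)) • G (t + θ) =
        (Real.exp (-(η * s)) - Real.exp (-(η * t))) • G (s + θ) +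
          Real.exp (-(η * t)) • (G (s + θ) - G (t + θ)) := by
      rw [sub_smul, smul_sub]; abel
    rw [this]
    refine (norm_add_le _ _).trans (add_le_add ?_ ?_)
    · rw [norm_smul, Real.norm_eq_abs]
      exact (mul_le_mul_of_nonneg_left (hC _) (abs_nonneg _)).trans hs.le
    · rw [BUC.norm_weight, ← dist_eq_norm]
      have := (@hG (s + θ) (t + θ) (by simpa using hsδ)).le
      calc _ ≤ Real.exp (-(η * t)) * (ε / (4 * Real.exp (-(η * t)))) := by gcongr
        _ = ε / 4 := by field_simp
  linarith

/-! ### Integrating a forcing term -/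

/-- The function with past `φ` and derivative `g` on `[0, ∞)`. -/
def orbit (φ : BUC η E) (g : ℝ → E) (r : ℝ) : E := φ (clip r) + ∫ s in (0 : ℝ)..max r 0, g s

theorem orbit_of_nonpos (φ : BUC η E) (g : ℝ → E) {r : ℝ} (hr : r ≤ 0) :
    orbit φ g r = φ ⟨r, hr⟩ := by
  rw [orbit, clip_of_nonpos hr, max_eq_right hr, intervalIntegral.integral_same, add_zero]

theorem orbit_coe (φ : BUC η E) (g : ℝ → E) (θ : Iic (0 : ℝ)) : orbit φ g θ = φ θ :=
  orbit_of_nonpos φ g θ.2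

theorem orbit_of_nonneg (φ : BUC η E) (g : ℝ → E) {r : ℝ} (hr : 0 ≤ r) :
    orbit φ g r = φ BUC.endpoint + ∫ s in (0 : ℝ)..r, g s := by
  rw [orbit, clip_of_nonneg hr, max_eq_left hr]

theorem orbit_congr (φ : BUC η E) {g h : ℝ → E} {t : ℝ} (H : EqOn g h (Icc 0 t)) {r : ℝ}
    (hr : r ≤ t) : orbit φ g r = orbit φ h r := by
  rcases le_total r 0 with h0 | h0
  · rw [orbit_of_nonpos φ g h0, orbit_of_nonpos φ h h0]
  · rw [orbit_of_nonneg φ g h0, orbit_of_nonneg φ h h0]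
    congr 1
    refine intervalIntegral.integral_congr fun s hs => ?_
    rw [uIcc_of_le h0] at hs
    exact H ⟨hs.1, hs.2.trans hr⟩

theorem continuous_orbit [CompleteSpace E] (φ : BUC η E) {g : ℝ → E} (hg : Continuous g) :
    Continuous (orbit φ g) := by
  have h1 : Continuous fun r => ∫ s in (0 : ℝ)..r, g s :=
    intervalIntegral.continuous_primitive (fun _ _ => hg.intervalIntegrable _ _) 0
  exact (φ.mem.1.comp continuous_clip).add (h1.comp (continuous_id.max continuous_const))

theorem orbit_mem (φ : BUC η E) (g : ℝ → E) :
    (fun θ : Iic (0 : ℝ) => orbit φ g θ) ∈ bucSubmodule η E := by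
  simpa only [orbit_coe] using φ.mem

/-- The trajectory in `BUC_η` of the solution of `u' = g` with past `φ`. -/
def trajectory [CompleteSpace E] (φ : BUC η E) (g : ℝ → E) (hg : Continuous g) (t : ℝ) : BUC η E :=
  history (orbit φ g) (continuous_orbit φ hg) (orbit_mem φ g) t

@[simp] theorem trajectory_apply [CompleteSpace E] (φ : BUC η E) {g : ℝ → E} (hg : Continuous g)
    (t : ℝ) (θ : Iic (0 : ℝ)) : trajectory φ g hg t θ = orbit φ g (t + θ) := rfl

theorem continuous_trajectory [CompleteSpace E] (φ : BUC η E) {g : ℝ → E} (hg : Continuous g) :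
    Continuous (trajectory φ g hg) :=
  continuous_history (continuous_orbit φ hg) (orbit_mem φ g)

/-- Shifting forward does not increase the weighted norm, since `θ ≤ min (t + θ) 0` and the weight
is nondecreasing for `η ≥ 0`. -/
theorem norm_past_le (hη : 0 ≤ η) (φ : BUC η E) {t : ℝ} (ht : 0 ≤ t) (θ : Iic (0 : ℝ)) :
    Real.exp (η * θ) * ‖φ (clip (t + θ))‖ ≤ ‖φ‖ := by
  refine le_trans ?_ (BUC.weight_le_norm φ (clip (t + θ)))
  refine mul_le_mul_of_nonneg_right (Real.exp_le_exp.mpr (mul_le_mul_of_nonneg_left ?_ hη))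
    (norm_nonneg _)
  exact le_min (by linarith) θ.2

theorem norm_integral_past_le (hη : 0 ≤ η) {t : ℝ} {h : ℝ → E} {b : ℝ → ℝ} (ht : 0 ≤ t)
    (hb : IntervalIntegrable b volume 0 t) (H : ∀ s ∈ Icc 0 t, ‖h s‖ ≤ b s) (θ : Iic (0 : ℝ)) :
    Real.exp (η * θ) * ‖∫ s in (0 : ℝ)..max (t + θ) 0, h s‖ ≤ ∫ s in (0 : ℝ)..t, b s := by
  have hθ : (θ : ℝ) ≤ 0 := θ.2
  have hr : max (t + θ) 0 ≤ t := max_le (by linarith) ht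
  have h1 : ‖∫ s in (0 : ℝ)..max (t + θ) 0, h s‖ ≤ ∫ s in (0 : ℝ)..max (t + θ) 0, b s := by
    refine intervalIntegral.norm_integral_le_of_norm_le (le_max_right _ _) ?_ ?_
    · exact Eventually.of_forall fun s hs => H s ⟨hs.1.le, hs.2.trans hr⟩
    · exact hb.mono_set (by
        rw [uIcc_of_le ht, uIcc_of_le (le_max_right _ _)]; exact Icc_subset_Icc_right hr)
  have h2 : ∫ s in (0 : ℝ)..max (t + θ) 0, b s ≤ ∫ s in (0 : ℝ)..t, b s := by
    refine intervalIntegral.integral_mono_interval le_rfl (le_max_right _ _) hr ?_ hb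
    filter_upwards [ae_restrict_mem measurableSet_Ioc] with s hs
    exact (norm_nonneg _).trans (H s ⟨hs.1.le, hs.2⟩)
  have h3 : Real.exp (η * θ) ≤ 1 :=
    Real.exp_le_one_iff.mpr (mul_nonpos_of_nonneg_of_nonpos hη hθ)
  calc _ ≤ 1 * ‖∫ s in (0 : ℝ)..max (t + θ) 0, h s‖ := by gcongr
    _ ≤ _ := by rw [one_mul]; exact h1.trans h2

theorem norm_le_integral (hη : 0 ≤ η) {t : ℝ} {h : ℝ → E} {b : ℝ → ℝ} (ht : 0 ≤ t) {y : BUC η E}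
    (hy : ∀ θ : Iic (0 : ℝ), y θ = ∫ s in (0 : ℝ)..max (t + θ) 0, h s)
    (hb : IntervalIntegrable b volume 0 t) (H : ∀ s ∈ Icc 0 t, ‖h s‖ ≤ b s) :
    ‖y‖ ≤ ∫ s in (0 : ℝ)..t, b s :=
  BUC.norm_le _ fun θ => by rw [hy]; exact norm_integral_past_le hη ht hb H θ

theorem norm_le_add_integral (hη : 0 ≤ η) {t : ℝ} {φ : BUC η E} {h : ℝ → E} {b : ℝ → ℝ}
    (ht : 0 ≤ t) {y : BUC η E} (hy : ∀ θ : Iic (0 : ℝ), y θ = orbit φ h (t + θ))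
    (hb : IntervalIntegrable b volume 0 t) (H : ∀ s ∈ Icc 0 t, ‖h s‖ ≤ b s) :
    ‖y‖ ≤ ‖φ‖ + ∫ s in (0 : ℝ)..t, b s := by
  refine BUC.norm_le _ fun θ => ?_
  rw [hy, orbit]
  calc _ ≤ Real.exp (η * θ) * (‖φ (clip (t + θ))‖ + ‖∫ s in (0 : ℝ)..max (t + θ) 0, h s‖) := by
        gcongr; exact norm_add_le _ _
    _ ≤ _ := by
        rw [mul_add]
        exact add_le_add (norm_past_le hη φ ht θ) (norm_integral_past_le hη ht hb H θ)

end InfiniteDelay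

/-! ### Grönwall's inequality and the delay equation: comparison, uniqueness, global existence -/

namespace InfiniteDelay

open Set Filter Topology MeasureTheory

/-- Grönwall's inequality in integral form. -/
theorem le_mul_exp_of_le_add_integral {y : ℝ → ℝ} {a b τ : ℝ} (hb : 0 ≤ b)
    (hy : ContinuousOn y (Icc 0 τ)) (H : ∀ t ∈ Icc 0 τ, y t ≤ a + b * ∫ s in (0 : ℝ)..t, y s) :
    ∀ t ∈ Icc 0 τ, y t ≤ a * Real.exp (b * t) := by
  intro t ht
  have hτ : 0 ≤ τ := ht.1.trans ht.2
  -- The extension of `y` by constants is continuous on `ℝ`, so its primitive is differentiable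
  -- everywhere.
  set z : ℝ → ℝ := IccExtend hτ (domRestrict (Icc 0 τ) y) with hz
  have hzc : Continuous z := (continuousOn_iff_continuous_domRestrict.mp hy).Icc_extend'
  have hzy : ∀ s ∈ Icc 0 τ, z s = y s := fun s hs => IccExtend_of_mem hτ _ hs
  have hint : ∀ s ∈ Icc 0 τ, ∫ σ in (0 : ℝ)..s, y σ = ∫ σ in (0 : ℝ)..s, z σ := by
    intro s hs
    refine intervalIntegral.integral_congr fun σ hσ => ?_
    rw [uIcc_of_le hs.1] at hσ
    exact (hzy σ ⟨hσ.1, hσ.2.trans hs.2⟩).symm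
  set I : ℝ → ℝ := fun s => ∫ σ in (0 : ℝ)..s, z σ with hI
  have hId : ∀ s, HasDerivAt I (z s) s := fun s => (hzc.integral_hasStrictDerivAt 0 s).hasDerivAt
  -- Integrating factor: `Z' = -b e^{-bs} (a + b I - z)`, which is nonpositive by hypothesis.
  set Z : ℝ → ℝ := fun s => (a + b * I s) * Real.exp (-(b * s)) with hZ
  have hZd : ∀ s, HasDerivAt Z
      (b * z s * Real.exp (-(b * s)) + (a + b * I s) * (Real.exp (-(b * s)) * -b)) s := by
    intro s
    have h1 : HasDerivAt (fun s => -(b * s)) (-b) s := by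
      simpa using ((hasDerivAt_id s).const_mul b).fun_neg
    exact (((hId s).const_mul b).const_add a).mul h1.exp
  have hanti : AntitoneOn Z (Icc 0 τ) := by
    refine antitoneOn_of_deriv_nonpos (convex_Icc 0 τ)
      (fun s _ => (hZd s).continuousAt.continuousWithinAt)
      (fun s _ => (hZd s).differentiableAt.differentiableWithinAt) fun s hs => ?_
    rw [interior_Icc] at hs
    have hs' : s ∈ Icc 0 τ := Ioo_subset_Icc_self hs
    rw [(hZd s).deriv]
    have h1 := H s hs'
    rw [hint s hs', ← hzy s hs'] at h1
    have h2 : b * z s * Real.exp (-(b * s)) + (a + b * I s) * (Real.exp (-(b * s)) * -b) =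
        -(b * Real.exp (-(b * s)) * (a + b * I s - z s)) := by ring
    rw [h2, neg_nonpos]
    exact mul_nonneg (mul_nonneg hb (Real.exp_pos _).le) (sub_nonneg.mpr h1)
  have h0 : Z t ≤ a := by
    have := hanti (left_mem_Icc.mpr hτ) ht ht.1
    simpa [hZ, hI] using this
  have h1 := H t ht
  rw [hint t ht] at h1
  calc y t ≤ a + b * I t := h1
    _ = Z t * Real.exp (b * t) := by rw [hZ]; simp [mul_assoc, ← Real.exp_add]
    _ ≤ a * Real.exp (b * t) := by gcongr

variable {η : ℝ} {E : Type*} [NormedAddCommGroup E] [NormedSpace ℝ E]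

/-- `v` is, on `[0, τ]`, the trajectory in `BUC_η` of a solution of the delay equation
`u'(t) = f(u_t)` with past `φ`. -/
structure IsDelaySolution (f : BUC η E → E) (φ : BUC η E) (τ : ℝ) (v : ℝ → BUC η E) : Prop where
  continuousOn : ContinuousOn v (Icc 0 τ)
  apply_eq : ∀ t ∈ Icc 0 τ, ∀ θ : Iic (0 : ℝ), v t θ = orbit φ (fun s => f (v s)) (t + θ)

namespace IsDelaySolution

variable {f : BUC η E → E} {φ ψ : BUC η E} {τ : ℝ} {v w : ℝ → BUC η E}

theorem mono (h : IsDelaySolution f φ τ v) {σ : ℝ} (hσ : σ ≤ τ) : IsDelaySolution f φ σ v :=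
  ⟨h.continuousOn.mono (Icc_subset_Icc_right hσ), fun t ht => h.apply_eq t ⟨ht.1, ht.2.trans hσ⟩⟩

theorem congr {g : BUC η E → E} (h : IsDelaySolution f φ τ v) (hvw : EqOn v w (Icc 0 τ))
    (hfg : ∀ t ∈ Icc 0 τ, f (v t) = g (v t)) : IsDelaySolution g φ τ w := by
  refine ⟨h.continuousOn.congr hvw.symm, fun t ht θ => ?_⟩
  have hθ : (θ : ℝ) ≤ 0 := θ.2
  rw [← hvw ht, h.apply_eq t ht θ]
  refine orbit_congr φ (t := τ) (fun s hs => ?_) (by linarith [ht.2])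
  rw [hfg s hs, hvw hs]

theorem apply_zero (h : IsDelaySolution f φ τ v) (hτ : 0 ≤ τ) : v 0 = φ := by
  refine DFunLike.ext _ _ fun θ => ?_
  rw [h.apply_eq 0 (left_mem_Icc.mpr hτ) θ, zero_add, orbit_coe]

theorem apply_endpoint (h : IsDelaySolution f φ τ v) {t : ℝ} (ht : t ∈ Icc 0 τ) :
    v t BUC.endpoint = φ BUC.endpoint + ∫ s in (0 : ℝ)..t, f (v s) := by
  rw [h.apply_eq t ht, BUC.endpoint, add_zero, orbit_of_nonneg _ _ ht.1]
  rfl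

/-- Comparison of a trajectory of `u' = f(u_t)` with one of `u' = g(u_t)` where `f` and `g` are
close along the second trajectory. -/
theorem norm_sub_le (hη : 0 ≤ η) {g : BUC η E → E} {κ c : ℝ} (hκ : 0 ≤ κ) (hc : 0 ≤ c)
    (hv : IsDelaySolution f φ τ v) (hw : IsDelaySolution g φ τ w)
    (hf : ContinuousOn (fun s => f (v s)) (Icc 0 τ))
    (hg : ContinuousOn (fun s => g (w s)) (Icc 0 τ))
    (H : ∀ s ∈ Icc 0 τ, ‖f (v s) - g (w s)‖ ≤ κ * ‖v s - w s‖ + c) :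
    ∀ t ∈ Icc 0 τ, ‖v t - w t‖ ≤ c * τ * Real.exp (κ * t) := by
  have hcont : ContinuousOn (fun s => ‖v s - w s‖) (Icc 0 τ) :=
    (hv.continuousOn.sub hw.continuousOn).norm
  refine le_mul_exp_of_le_add_integral hκ hcont fun t ht => ?_
  have hsub : Icc 0 t ⊆ Icc 0 τ := Icc_subset_Icc_right ht.2
  have hIcc : ∀ r ∈ Icc 0 t, uIcc 0 r ⊆ Icc 0 τ := by
    intro r hr
    rw [uIcc_of_le hr.1]
    exact Icc_subset_Icc_right (hr.2.trans ht.2)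
  have hiE : ∀ {h : ℝ → E}, ContinuousOn h (Icc 0 τ) →
      ∀ r ∈ Icc 0 t, IntervalIntegrable h volume 0 r :=
    fun hh r hr => (hh.mono (hIcc r hr)).intervalIntegrable
  have hiR : ∀ {h : ℝ → ℝ}, ContinuousOn h (Icc 0 τ) →
      ∀ r ∈ Icc 0 t, IntervalIntegrable h volume 0 r :=
    fun hh r hr => (hh.mono (hIcc r hr)).intervalIntegrable
  have ht' : t ∈ Icc 0 t := right_mem_Icc.mpr ht.1
  have h1 : ‖v t - w t‖ ≤ ∫ s in (0 : ℝ)..t, (κ * ‖v s - w s‖ + c) := by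
    refine norm_le_integral hη ht.1 (h := fun s => f (v s) - g (w s)) (fun θ => ?_)
      (hiR ((hcont.const_mul κ).add continuousOn_const) t ht') fun s hs => H s (hsub hs)
    have hθ : (θ : ℝ) ≤ 0 := θ.2
    have hr : max (t + θ) 0 ∈ Icc 0 t := ⟨le_max_right _ _, max_le (by linarith) ht.1⟩
    rw [BUC.coe_sub, Pi.sub_apply, hv.apply_eq t ht, hw.apply_eq t ht, orbit, orbit,
      intervalIntegral.integral_sub (hiE hf _ hr) (hiE hg _ hr)]
    abel
  rw [intervalIntegral.integral_add (hiR (hcont.const_mul κ) t ht')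
    (by simp), intervalIntegral.integral_const_mul] at h1
  simp only [intervalIntegral.integral_const, sub_zero, smul_eq_mul] at h1
  nlinarith [ht.2]

theorem norm_le (hη : 0 ≤ η) {κ : ℝ} (hκ : 0 ≤ κ) (hv : IsDelaySolution f φ τ v)
    (H : ∀ s ∈ Icc 0 τ, ‖f (v s)‖ ≤ κ * ‖v s‖) :
    ∀ t ∈ Icc 0 τ, ‖v t‖ ≤ ‖φ‖ * Real.exp (κ * t) := by
  refine le_mul_exp_of_le_add_integral hκ hv.continuousOn.norm fun t ht => ?_
  have hsub : Icc 0 t ⊆ Icc 0 τ := Icc_subset_Icc_right ht.2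
  rw [← intervalIntegral.integral_const_mul]
  refine norm_le_add_integral hη ht.1 (hv.apply_eq t ht) ?_ fun s hs => H s (hsub hs)
  refine ContinuousOn.intervalIntegrable ?_
  rw [uIcc_of_le ht.1]
  exact ((hv.continuousOn.norm.const_smul κ).mono hsub)

/-- Solutions are unique when `f` is Lipschitz on balls. -/
theorem eqOn (hη : 0 ≤ η)
    (hf : ∀ ξ : ℝ, 0 < ξ → ∃ κ : ℝ, ∀ φ ψ : BUC η E, ‖φ‖ ≤ ξ → ‖ψ‖ ≤ ξ →
      ‖f φ - f ψ‖ ≤ κ * ‖φ - ψ‖)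
    (hfc : Continuous f) (hv : IsDelaySolution f φ τ v) (hw : IsDelaySolution f φ τ w) :
    EqOn v w (Icc 0 τ) := by
  intro t ht
  obtain ⟨C, hC⟩ := isCompact_Icc.exists_bound_of_continuousOn hv.continuousOn
  obtain ⟨D, hD⟩ := isCompact_Icc.exists_bound_of_continuousOn hw.continuousOn
  -- One ball contains both trajectories; the `1` keeps its radius positive. The constant `κ` may be
  -- negative, whence `max κ 0` in the comparison.
  obtain ⟨κ, hκ⟩ := hf (max (max C D) 1) (by positivity)
  have := norm_sub_le hη (le_max_right κ 0) le_rfl hv hw (hfc.comp_continuousOn hv.continuousOn)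
    (hfc.comp_continuousOn hw.continuousOn) (fun s hs => ?_) t ht
  · rw [zero_mul, zero_mul] at this
    exact sub_eq_zero.mp (norm_le_zero_iff.mp this)
  · rw [add_zero]
    refine (hκ _ _ ((hC s hs).trans ?_) ((hD s hs).trans ?_)).trans ?_
    · exact (le_max_left C D).trans (le_max_left _ _)
    · exact (le_max_right C D).trans (le_max_left _ _)
    · gcongr
      exact le_max_left _ _

/-- Translation in time. -/
theorem translate (hfc : Continuous f) (hv : IsDelaySolution f φ τ v) {σ ρ : ℝ} (hσ : 0 ≤ σ)
    (hρ : 0 ≤ ρ) (h : σ + ρ ≤ τ) : IsDelaySolution f (v σ) ρ fun t => v (σ + t) := by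
  have hmaps : MapsTo (fun t => σ + t) (Icc 0 ρ) (Icc 0 τ) := fun t ht =>
    ⟨by linarith [ht.1], by linarith [ht.2]⟩
  refine ⟨hv.continuousOn.comp (by fun_prop) hmaps, fun t ht θ => ?_⟩
  have hσ' : σ ∈ Icc 0 τ := ⟨hσ, by linarith⟩
  have hθ : (θ : ℝ) ≤ 0 := θ.2
  rw [hv.apply_eq _ (hmaps ht)]
  rcases le_total (t + θ) 0 with h0 | h0
  · rw [orbit_of_nonpos _ _ h0, hv.apply_eq σ hσ']
    congr 1
    ring
  · rw [orbit_of_nonneg _ _ h0, hv.apply_endpoint hσ',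
      orbit_of_nonneg _ _ (by linarith : 0 ≤ σ + t + θ), add_assoc (φ BUC.endpoint)]
    congr 1
    have hc : ContinuousOn (fun s => f (v s)) (Icc 0 τ) := hfc.comp_continuousOn hv.continuousOn
    have hii : ∀ a ∈ Icc 0 τ, ∀ b ∈ Icc 0 τ, IntervalIntegrable (fun s => f (v s)) volume a b :=
      fun a ha b hb => (hc.mono (uIcc_subset_Icc ha hb)).intervalIntegrable
    have h1 : ∫ s in (0 : ℝ)..t + θ, f (v (σ + s)) = ∫ s in σ..σ + t + θ, f (v s) := by
      rw [intervalIntegral.integral_comp_add_left (fun s => f (v s))]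
      congr 1 <;> ring
    have hm : σ + t + θ ∈ Icc 0 τ := ⟨by linarith, by linarith [ht.2]⟩
    rw [h1, intervalIntegral.integral_add_adjacent_intervals (hii 0 ⟨le_rfl, by linarith⟩ σ hσ')
      (hii σ hσ' _ hm)]

end IsDelaySolution

/-- Global existence for a globally Lipschitz right-hand side vanishing at `0`. -/
theorem exists_isDelaySolution [CompleteSpace E] (hη : 0 ≤ η) {f : BUC η E → E} {κ : ℝ≥0}
    (hf : LipschitzWith κ f) (hf0 : f 0 = 0) (φ : BUC η E) :
    ∃ v : ℝ → BUC η E, Continuous v ∧ ∀ τ, IsDelaySolution f φ τ v := by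
  -- Bielecki weight: measured with `e^{-at}`, the Picard map has Lipschitz constant `κ / a ≤ 1/2`
  -- on the whole half-line, so a single fixed point serves every `τ`.
  set a : ℝ := 2 * (κ + 1) with ha
  have ha0 : 0 < a := by positivity
  have hfn : ∀ ψ, ‖f ψ‖ ≤ κ * ‖ψ‖ := fun ψ => by
    simpa [hf0, dist_eq_norm] using hf.dist_le_mul ψ 0
  have hexp : ∀ t, ∫ s in (0 : ℝ)..t, Real.exp (a * s) = (Real.exp (a * t) - 1) / a := by
    intro t
    rw [intervalIntegral.integral_comp_mul_left (fun s => Real.exp s) ha0.ne', integral_exp]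
    simp [div_eq_inv_mul]
  set g : BoundedContinuousFunction ℝ (BUC η E) → ℝ → E :=
    fun w s => f (Real.exp (a * s) • w s) with hg
  have hgc : ∀ w, Continuous (g w) := fun w =>
    hf.continuous.comp ((by fun_prop : Continuous fun s : ℝ => Real.exp (a * s)).smul w.continuous)
  -- The Picard map in the unknown `w(t) = e^{-at} v(t)`. Freezing it for negative times keeps it
  -- within the bounded continuous functions on `ℝ`.
  set Φ : BoundedContinuousFunction ℝ (BUC η E) → ℝ → BUC η E := fun w t =>
    Real.exp (-(a * max t 0)) • trajectory φ (g w) (hgc w) (max t 0) with hΦ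
  have hΦc : ∀ w, Continuous (Φ w) := fun w => by
    have h1 : Continuous fun t : ℝ => Real.exp (-(a * max t 0)) := by fun_prop
    have h2 : Continuous fun t : ℝ => max t 0 := by fun_prop
    exact h1.smul ((continuous_trajectory φ (hgc w)).comp h2)
  have hmul : ∀ t D : ℝ, 0 ≤ D → Real.exp (-(a * t)) * ∫ s in (0 : ℝ)..t, κ * (Real.exp (a * s) * D) ≤
      D / 2 := by
    intro t D hD
    rw [intervalIntegral.integral_const_mul, intervalIntegral.integral_mul_const, hexp]
    have h1 : Real.exp (-(a * t)) * Real.exp (a * t) = 1 := by rw [← Real.exp_add]; simp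
    have h2 : Real.exp (-(a * t)) * (κ * ((Real.exp (a * t) - 1) / a * D)) =
        κ * D / a * (1 - Real.exp (-(a * t))) := by
      field_simp
      linear_combination (κ : ℝ) * D * h1
    rw [h2]
    calc κ * D / a * (1 - Real.exp (-(a * t))) ≤ κ * D / a * 1 := by
          gcongr; linarith [Real.exp_pos (-(a * t))]
      _ ≤ D / 2 := by
          rw [mul_one, ha, div_le_div_iff₀ (by positivity) two_pos]
          nlinarith
  have hΦb : ∀ w t, ‖Φ w t‖ ≤ ‖φ‖ + ‖w‖ / 2 := by
    intro w t
    set T := max t 0 with hT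
    have hT0 : 0 ≤ T := le_max_right _ _
    have h1 : ‖trajectory φ (g w) (hgc w) T‖ ≤
        ‖φ‖ + ∫ s in (0 : ℝ)..T, κ * (Real.exp (a * s) * ‖w‖) := by
      refine norm_le_add_integral hη hT0 (fun θ => rfl)
        (Continuous.intervalIntegrable (by fun_prop) _ _) fun s _ => ?_
      refine (hfn _).trans ?_
      rw [norm_smul, Real.norm_eq_abs, Real.abs_exp]
      gcongr
      exact w.norm_coe_le_norm s
    have h2 : Real.exp (-(a * T)) ≤ 1 := Real.exp_le_one_iff.mpr (by nlinarith)
    change ‖Real.exp (-(a * T)) • trajectory φ (g w) (hgc w) T‖ ≤ _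
    rw [norm_smul, Real.norm_eq_abs, Real.abs_exp]
    calc _ ≤ Real.exp (-(a * T)) * (‖φ‖ + ∫ s in (0 : ℝ)..T, κ * (Real.exp (a * s) * ‖w‖)) := by
          gcongr
      _ ≤ _ := by
          rw [mul_add]
          exact add_le_add (mul_le_of_le_one_left (norm_nonneg _) h2) (hmul T _ (norm_nonneg _))
  set Ψ : BoundedContinuousFunction ℝ (BUC η E) → BoundedContinuousFunction ℝ (BUC η E) :=
    fun w => BoundedContinuousFunction.ofNormedAddCommGroup (Φ w) (hΦc w) _ (hΦb w) with hΨ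
  have hcontr : ContractingWith (1 / 2) Ψ := by
    refine ⟨by rw [← NNReal.coe_lt_coe]; norm_num, LipschitzWith.of_dist_le_mul fun w w' => ?_⟩
    refine (BoundedContinuousFunction.dist_le (by positivity)).mpr fun t => ?_
    set T := max t 0 with hT
    have hT0 : 0 ≤ T := le_max_right _ _
    have h1 : ‖trajectory φ (g w) (hgc w) T - trajectory φ (g w') (hgc w') T‖ ≤
        ∫ s in (0 : ℝ)..T, κ * (Real.exp (a * s) * dist w w') := by
      refine norm_le_integral hη hT0 (h := fun s => g w s - g w' s) (fun θ => ?_)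
        (Continuous.intervalIntegrable (by fun_prop) _ _) fun s _ => ?_
      · rw [BUC.coe_sub, Pi.sub_apply, trajectory_apply, trajectory_apply, orbit, orbit,
          intervalIntegral.integral_sub ((hgc w).intervalIntegrable _ _)
            ((hgc w').intervalIntegrable _ _)]
        abel
      · rw [← dist_eq_norm]
        refine (hf.dist_le_mul _ _).trans ?_
        rw [dist_smul₀, Real.norm_eq_abs, Real.abs_exp]
        gcongr
        exact BoundedContinuousFunction.dist_coe_le_dist s
    change dist (Real.exp (-(a * T)) • trajectory φ (g w) (hgc w) T)
      (Real.exp (-(a * T)) • trajectory φ (g w') (hgc w') T) ≤ _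
    rw [dist_smul₀, Real.norm_eq_abs, Real.abs_exp, dist_eq_norm (trajectory _ _ _ _)]
    calc _ ≤ Real.exp (-(a * T)) * ∫ s in (0 : ℝ)..T, κ * (Real.exp (a * s) * dist w w') := by
          gcongr
      _ ≤ dist w w' / 2 := hmul T _ dist_nonneg
      _ = _ := by push_cast; ring
  set w := ContractingWith.fixedPoint Ψ hcontr
  have hw : Ψ w = w := hcontr.fixedPoint_isFixedPt
  have hwt : ∀ t, 0 ≤ t → Real.exp (a * t) • w t = trajectory φ (g w) (hgc w) t := by
    intro t ht
    have h1 : w t = Real.exp (-(a * max t 0)) • trajectory φ (g w) (hgc w) (max t 0) := by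
      conv_lhs => rw [← hw]
      rfl
    rw [max_eq_left ht] at h1
    rw [h1, smul_smul, ← Real.exp_add]
    simp
  have hvc : Continuous fun t => Real.exp (a * t) • w t :=
    (by fun_prop : Continuous fun s : ℝ => Real.exp (a * s)).smul w.continuous
  refine ⟨fun t => Real.exp (a * t) • w t, hvc, fun τ => ⟨hvc.continuousOn, fun t ht θ => ?_⟩⟩
  rw [hwt t ht.1]
  rfl

end InfiniteDelay

namespace InfiniteDelay

open Set Filter Topology MeasureTheory

variable {η : ℝ} {E : Type*} [NormedAddCommGroup E] [NormedSpace ℝ E]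

/-! ### Integrated trajectories -/

theorem iicExtend_eq {α : Type*} (φ : Iic (0 : ℝ) → α) : IicExtend φ = fun r => φ (clip r) := by
  funext r
  exact congrArg φ (Subtype.ext (min_comm _ _))

namespace BUC

/-- Evaluation is jointly continuous because the norm controls values locally uniformly in `θ`. This
is needed along characteristics, where the history and the evaluation point move together. -/
theorem tendsto_apply {α : Type*} {l : Filter α} {ψ : α → BUC η E} {ψ₀ : BUC η E}
    {θ : α → Iic (0 : ℝ)} {θ₀ : Iic (0 : ℝ)} (hψ : Tendsto ψ l (𝓝 ψ₀)) (hθ : Tendsto θ l (𝓝 θ₀)) :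
    Tendsto (fun a => ψ a (θ a)) l (𝓝 (ψ₀ θ₀)) := by
  have h1 : Tendsto (fun a => ψ₀ (θ a)) l (𝓝 (ψ₀ θ₀)) := (ψ₀.mem.1.tendsto θ₀).comp hθ
  have h2 : Tendsto (fun a => Real.exp (-(η * θ a)) * ‖ψ a - ψ₀‖) l (𝓝 0) := by
    have h3 : Tendsto (fun a => Real.exp (-(η * θ a))) l (𝓝 (Real.exp (-(η * θ₀)))) :=
      ((by fun_prop : Continuous fun θ : Iic (0 : ℝ) => Real.exp (-(η * θ))).tendsto θ₀).comp hθ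
    have h4 : Tendsto (fun a => ‖ψ a - ψ₀‖) l (𝓝 0) := tendsto_iff_norm_sub_tendsto_zero.mp hψ
    simpa using h3.mul h4
  have h5 : Tendsto (fun a => (ψ a - ψ₀) (θ a)) l (𝓝 0) :=
    squeeze_zero_norm (fun a => norm_apply_le _ _) h2
  simpa using h5.add h1

theorem continuous_apply {α : Type*} [TopologicalSpace α] {ψ : α → BUC η E} {θ : α → Iic (0 : ℝ)}
    (hψ : Continuous ψ) (hθ : Continuous θ) : Continuous fun a => ψ a (θ a) :=
  continuous_iff_continuousAt.mpr fun a => tendsto_apply (hψ.tendsto a) (hθ.tendsto a)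

theorem hasDerivWithinAt_of_mem_C1 (φ : C1 η E) (θ : Iic (0 : ℝ)) :
    HasDerivWithinAt (fun r => φ.1 (clip r)) (derivL φ θ) (Iic 0) θ := by
  have h : HasDerivWithinAt (IicExtend φ.1) (derivL φ θ) (Iic 0) θ :=
    (φ.2.1 θ θ.2).hasDerivWithinAt
  rwa [iicExtend_eq] at h

theorem mem_C1_of_hasDerivAt {φ ψ : BUC η E} {p : ℝ → E} (hp : ∀ θ : Iic (0 : ℝ), p θ = φ θ)
    (hd : ∀ θ : Iic (0 : ℝ), HasDerivAt p (ψ θ) θ) :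
    ∃ h : φ ∈ C1 η E, derivL ⟨φ, h⟩ = ψ := by
  have hd' : ∀ θ : Iic (0 : ℝ), HasDerivWithinAt (IicExtend φ) (ψ θ) (Iic 0) θ := by
    intro θ
    refine (hd θ).hasDerivWithinAt.congr (fun r hr => ?_) ?_
    · rw [iicExtend_eq]
      exact (congrArg φ (clip_of_nonpos hr)).trans (hp ⟨r, hr⟩).symm
    · rw [iicExtend_eq]
      exact (congrArg φ (clip_coe θ)).trans (hp θ).symm
  have he : derivIic φ = ψ := funext fun θ => (hd' θ).derivWithin (uniqueDiffOn_Iic 0 θ θ.2)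
  refine ⟨⟨fun θ hθ => (hd' ⟨θ, hθ⟩).differentiableWithinAt, ?_⟩, DFunLike.coe_injective he⟩
  rw [he]
  exact ψ.mem

variable [CompleteSpace E]

theorem integral_apply {v : ℝ → BUC η E} {a b : ℝ} (hv : IntervalIntegrable v volume a b)
    (θ : Iic (0 : ℝ)) : (∫ s in a..b, v s) θ = ∫ s in a..b, v s θ :=
  ((evalL η E θ).intervalIntegral_comp_comm hv).symm

/-- The time integral of the trajectory of a continuous function is `C¹`. -/
theorem integral_mem_C1 {u : ℝ → E} (hu : Continuous u) {v : ℝ → BUC η E} {t : ℝ} (ht : 0 ≤ t)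
    (hv : ContinuousOn v (Icc 0 t))
    (h : ∀ s ∈ Icc 0 t, ∀ θ : Iic (0 : ℝ), v s θ = u (s + θ)) :
    ∃ h : (∫ s in (0 : ℝ)..t, v s) ∈ C1 η E, derivL ⟨_, h⟩ = v t - v 0 := by
  have hii : ∀ a b, IntervalIntegrable u volume a b := fun a b => hu.intervalIntegrable a b
  -- The function `p θ = ∫ u` over `[θ, t + θ]` is differentiable on all of `ℝ`, with derivative `u
  -- (t + θ) - u θ`, so the endpoint needs no separate argument.
  refine mem_C1_of_hasDerivAt
    (p := fun θ => (∫ s in (0 : ℝ)..t + θ, u s) - ∫ s in (0 : ℝ)..θ, u s) (fun θ => ?_) fun θ => ?_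
  · have hvi : IntervalIntegrable v volume 0 t :=
      ContinuousOn.intervalIntegrable (by rwa [uIcc_of_le ht])
    rw [integral_apply hvi, intervalIntegral.integral_interval_sub_left (hii _ _) (hii _ _)]
    have h1 : ∫ s in (0 : ℝ)..t, v s θ = ∫ s in (0 : ℝ)..t, u (s + θ) := by
      refine intervalIntegral.integral_congr fun s hs => ?_
      rw [uIcc_of_le ht] at hs
      exact h s hs θ
    rw [h1, intervalIntegral.integral_comp_add_right u, zero_add]
  · rw [coe_sub, Pi.sub_apply, h t ⟨ht, le_rfl⟩, h 0 ⟨le_rfl, ht⟩, zero_add]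
    have hd : ∀ r, HasDerivAt (fun r => ∫ s in (0 : ℝ)..r, u s) (u r) r := fun r =>
      (hu.integral_hasStrictDerivAt 0 r).hasDerivAt
    exact ((hd (t + θ)).comp_const_add t (θ : ℝ)).sub (hd θ)

end BUC

/-! ### The transport equation: method of characteristics -/

section Transport

variable [CompleteSpace E]

/-- The derivative of the integrated trajectory along a characteristic. -/
theorem hasDerivAt_characteristic {φ : BUC η E} {τ : ℝ} {v : ℝ → BUC η E} (hv : Continuous v)
    (h : ∀ t ∈ Icc 0 τ, ∃ h : (∫ s in (0 : ℝ)..t, v s) ∈ BUC.C1 η E,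
      v t = φ + BUC.derivL ⟨_, h⟩) {c σ : ℝ} (hσ : σ ∈ Icc 0 τ) (hc : c < σ) :
    HasDerivAt (fun σ => (∫ s in (0 : ℝ)..σ, v s) (clip (c - σ))) (φ (clip (c - σ))) σ := by
  set I : ℝ → BUC η E := fun σ => ∫ s in (0 : ℝ)..σ, v s with hI
  have hId : HasDerivAt I (v σ) σ := (hv.integral_hasStrictDerivAt 0 σ).hasDerivAt
  obtain ⟨hmem, heq⟩ := h σ hσ
  have h1 : HasDerivAt (fun y => I σ (clip (c - y)))
      (-(BUC.derivL ⟨I σ, hmem⟩ (clip (c - σ)))) σ := by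
    have h2 := BUC.hasDerivWithinAt_of_mem_C1 ⟨I σ, hmem⟩ (clip (c - σ))
    have h3 : ((clip (c - σ) : Iic (0 : ℝ)) : ℝ) = c - σ := min_eq_left (by linarith)
    rw [h3] at h2
    have h4 := h2.hasDerivAt (Iic_mem_nhds (by linarith))
    simpa using h4.comp_const_sub c σ
  rw [hasDerivAt_iff_tendsto_slope] at hId h1 ⊢
  have hcl : Tendsto (fun y => clip (c - y)) (𝓝[≠] σ) (𝓝 (clip (c - σ))) :=
    ((continuous_clip.comp (by fun_prop : Continuous fun y => c - y)).tendsto σ).mono_left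
      nhdsWithin_le_nhds
  -- Product rule: the difference quotient is the quotient of `I` in time, evaluated at the moving
  -- point, plus the quotient of `I σ` along the moving point. In the limit the terms `v σ` and `-(I
  -- σ)'` add up to `φ` by the equation; this is where the transport equation enters.
  have h5 := (BUC.tendsto_apply hId hcl).add h1
  have h6 : v σ (clip (c - σ)) + -(BUC.derivL ⟨I σ, hmem⟩ (clip (c - σ))) = φ (clip (c - σ)) := by
    rw [heq, BUC.coe_add, Pi.add_apply]
    exact add_neg_cancel_right _ _
  rw [h6] at h5
  refine h5.congr fun y => ?_
  simp only [slope, vsub_eq_sub, BUC.coe_smul, BUC.coe_sub, Pi.smul_apply, Pi.sub_apply]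
  rw [← smul_add]
  congr 1
  abel

/-- The fundamental theorem of calculus along a characteristic. The derivative is only needed on the
open interval, so `c = s`, where the characteristic starts at the endpoint, is allowed. -/
theorem integral_apply_eq_along_characteristic {φ : BUC η E} {τ : ℝ} {v : ℝ → BUC η E}
    (hv : Continuous v)
    (h : ∀ t ∈ Icc 0 τ, ∃ h : (∫ s in (0 : ℝ)..t, v s) ∈ BUC.C1 η E,
      v t = φ + BUC.derivL ⟨_, h⟩) {s t : ℝ} (hs : 0 ≤ s) (hst : s ≤ t) (ht : t ≤ τ) {c : ℝ}
    (hc : c ≤ s) :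
    (∫ s in (0 : ℝ)..t, v s) (clip (c - t)) = (∫ s in (0 : ℝ)..s, v s) (clip (c - s)) +
      ∫ r in c - t..c - s, φ (clip r) := by
  have hcl : Continuous fun σ => clip (c - σ) := continuous_clip.comp (by fun_prop)
  have hI : Continuous fun σ => ∫ s in (0 : ℝ)..σ, v s :=
    intervalIntegral.continuous_primitive (fun _ _ => hv.intervalIntegrable _ _) 0
  have h1 := intervalIntegral.integral_eq_sub_of_hasDerivAt_of_le hst
    (BUC.continuous_apply hI hcl).continuousOn
    (fun σ hσ => hasDerivAt_characteristic hv h ⟨hs.trans hσ.1.le, hσ.2.le.trans ht⟩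
      (hc.trans_lt hσ.1))
    ((φ.mem.1.comp hcl).intervalIntegrable _ _)
  rw [← intervalIntegral.integral_comp_sub_left (fun r => φ (clip r)) c, h1]
  abel

/-- The transport equation with boundary condition determines the trajectory. -/
theorem apply_eq_orbit_of_transport {φ : BUC η E} {τ : ℝ} {v : ℝ → BUC η E} {g : ℝ → E}
    (hv : ContinuousOn v (Icc 0 τ))
    (h : ∀ t ∈ Icc 0 τ, ∃ h : (∫ s in (0 : ℝ)..t, v s) ∈ BUC.C1 η E,
      v t = φ + BUC.derivL ⟨_, h⟩)
    (h0 : ∀ t ∈ Icc 0 τ, v t BUC.endpoint = φ BUC.endpoint + ∫ s in (0 : ℝ)..t, g s) :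
    ∀ t ∈ Icc 0 τ, ∀ θ : Iic (0 : ℝ), v t θ = orbit φ g (t + θ) := by
  intro t ht θ
  have hθ : (θ : ℝ) ≤ 0 := θ.2
  have hτ : 0 ≤ τ := ht.1.trans ht.2
  -- Every hypothesis involves `v` on `[0, τ]` only, so `v` may be extended by constants.
  wlog hvc : Continuous v generalizing v
  · have hwv : ∀ s ∈ Icc 0 τ, IccExtend hτ (domRestrict (Icc 0 τ) v) s = v s :=
      fun s hs => IccExtend_of_mem hτ _ hs
    have hwc : Continuous (IccExtend hτ (domRestrict (Icc 0 τ) v)) :=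
      (continuousOn_iff_continuous_domRestrict.mp hv).Icc_extend'
    rw [← hwv t ht]
    refine this hwc.continuousOn (fun s hs => ?_) (fun s hs => ?_) hwc
    · have : ∫ σ in (0 : ℝ)..s, IccExtend hτ (domRestrict (Icc 0 τ) v) σ =
          ∫ σ in (0 : ℝ)..s, v σ := by
        refine intervalIntegral.integral_congr fun σ hσ => ?_
        rw [uIcc_of_le hs.1] at hσ
        exact hwv σ ⟨hσ.1, hσ.2.trans hs.2⟩
      rw [this, hwv s hs]
      exact h s hs
    · rw [hwv s hs]
      exact h0 s hs
  have hId : ∀ θ : Iic (0 : ℝ), ∀ t,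
      HasDerivAt (fun t => (∫ s in (0 : ℝ)..t, v s) θ) (v t θ) t := fun θ t =>
    (BUC.evalL η E θ).hasFDerivAt.comp_hasDerivAt t (hvc.integral_hasStrictDerivAt 0 t).hasDerivAt
  have hcl : ∀ t : ℝ, clip (t + θ - t) = θ := fun t => by rw [add_sub_cancel_left, clip_coe]
  -- Traced backwards, the characteristic through `(t, θ)` reaches the initial data if `t + θ ≤ 0`
  -- and the endpoint `θ = 0` otherwise. In both cases the integral of `v` over `[0, s]`, evaluated
  -- at `θ`, has an explicit form for `s ≤ t`, and comparing left derivatives at `s = t` gives the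
  -- value of `v t θ`. For `t = 0` there is no interval to the left, so that case is separate.
  rcases le_or_gt (t + θ) 0 with hc | hc
  · rcases ht.1.eq_or_lt with rfl | ht0
    · obtain ⟨hm, h1⟩ := h 0 ht
      have h2 : (⟨_, hm⟩ : BUC.C1 η E) = 0 := Subtype.ext intervalIntegral.integral_same
      rw [h1, h2, map_zero, add_zero, zero_add, orbit_coe]
    · have hd : HasDerivAt (fun t => ∫ r in (θ : ℝ)..t + θ, φ (clip r)) (φ (clip (t + θ))) t := by
        have hφ : Continuous fun r => φ (clip r) := φ.mem.1.comp continuous_clip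
        exact ((hφ.integral_hasStrictDerivAt θ (t + θ)).hasDerivAt).comp_add_const t (θ : ℝ)
      have heq : ∀ s ∈ Icc 0 t, (∫ r in (0 : ℝ)..s, v r) θ = ∫ r in (θ : ℝ)..s + θ, φ (clip r) := by
        intro s hs
        have := integral_apply_eq_along_characteristic hvc h le_rfl hs.1 (hs.2.trans ht.2)
          (c := s + θ) (by linarith [hs.2])
        rw [hcl] at this
        rw [this, intervalIntegral.integral_same]
        simp
      have htm : t ∈ Icc 0 t := ⟨ht.1, le_rfl⟩
      rw [orbit_of_nonpos _ _ hc, ← clip_of_nonpos hc]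
      exact (uniqueDiffOn_Icc ht0 t htm).eq_deriv _ (hId θ t).hasDerivWithinAt
        (hd.hasDerivWithinAt.congr heq (heq t htm))
  · have hd : HasDerivAt
        (fun t => (∫ r in (0 : ℝ)..t + θ, v r) BUC.endpoint + ∫ r in (θ : ℝ)..0, φ (clip r))
        (v (t + θ) BUC.endpoint) t :=
      ((hId BUC.endpoint (t + θ)).comp_add_const t (θ : ℝ)).add_const _
    have heq : ∀ s ∈ Icc (-θ : ℝ) t, (∫ r in (0 : ℝ)..s, v r) θ =
        (∫ r in (0 : ℝ)..s + θ, v r) BUC.endpoint + ∫ r in (θ : ℝ)..0, φ (clip r) := by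
      intro s hs
      have := integral_apply_eq_along_characteristic hvc h (s := s + θ) (by linarith [hs.1])
        (by linarith) (hs.2.trans ht.2) (c := s + θ) le_rfl
      rw [hcl] at this
      rw [this, sub_self, clip_of_nonneg le_rfl, add_sub_cancel_left]
    have htm : t ∈ Icc (-θ : ℝ) t := ⟨by linarith, le_rfl⟩
    rw [orbit_of_nonneg _ _ hc.le, ← h0 _ ⟨hc.le, by linarith [ht.2]⟩]
    exact (uniqueDiffOn_Icc (by linarith : (-θ : ℝ) < t) t htm).eq_deriv _
      (hId θ t).hasDerivWithinAt (hd.hasDerivWithinAt.congr heq (heq t htm))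

end Transport

/-! ### Mild solutions are trajectories of the delay equation -/

variable {n : ℕ}

/-- For density, `φ` is continued by a constant. The averages `t⁻¹ ∫ v` over `[0, t]` of the
resulting trajectory are `C¹` and tend to `v 0 = φ` as `t ↓ 0`. -/
theorem mem_X₀_iff {x : X n η} : x ∈ X₀ n η ↔ x.fst = 0 := by
  constructor
  · intro h
    have hc : IsClosed {x : X n η | x.fst = 0} :=
      isClosed_eq (WithLp.fstL 1 ℝ _ _).continuous continuous_const
    exact closure_minimal (fun y hy => hy.1) hc h
  · intro hx
    set v := trajectory x.snd (fun _ => 0) continuous_const with hv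
    have hvc : Continuous v := continuous_trajectory _ _
    have h0 : v 0 = x.snd := DFunLike.ext _ _ fun θ => by
      rw [hv, trajectory_apply, zero_add, orbit_coe]
    have h1 := (hvc.integral_hasStrictDerivAt 0 0).hasDerivAt
    rw [hasDerivAt_iff_tendsto_slope_zero, h0] at h1
    have h2 := h1.mono_left (nhdsWithin_mono 0 (fun y (hy : 0 < y) => hy.ne') :
      𝓝[>] (0 : ℝ) ≤ 𝓝[≠] 0)
    have hcont : Continuous fun φ : BUC η (EuclideanSpace ℝ (Fin n)) =>
        (WithLp.toLp 1 (0, φ) : X n η) :=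
      (WithLp.prod_continuous_toLp 1 _ _).comp (by fun_prop)
    have h3 := (hcont.tendsto x.snd).comp h2
    have h4 : (WithLp.toLp 1 (0, x.snd) : X n η) = x := by
      rw [← hx]; rfl
    rw [h4] at h3
    refine mem_closure_of_tendsto h3 ?_
    filter_upwards [self_mem_nhdsWithin] with t (ht : 0 < t)
    refine ⟨rfl, ?_⟩
    obtain ⟨h5, -⟩ := BUC.integral_mem_C1 (continuous_orbit x.snd (g := fun _ => 0) continuous_const)
      ht.le hvc.continuousOn fun s _ θ => trajectory_apply _ _ s θ
    simpa using Submodule.smul_mem _ t⁻¹ h5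

theorem LipschitzOnBounded.continuous
    {f : BUC η (EuclideanSpace ℝ (Fin n)) → EuclideanSpace ℝ (Fin n)} (hf : LipschitzOnBounded f) :
    Continuous f := by
  rw [continuous_iff_continuousAt]
  intro φ
  obtain ⟨κ, hκ⟩ := hf (‖φ‖ + 1) (by positivity)
  rw [ContinuousAt, tendsto_iff_norm_sub_tendsto_zero]
  have h1 : Tendsto (fun ψ => κ * ‖ψ - φ‖) (𝓝 φ) (𝓝 0) := by
    have : Continuous fun ψ => κ * ‖ψ - φ‖ := by fun_prop
    simpa using this.tendsto φ
  refine squeeze_zero' (Eventually.of_forall fun _ => norm_nonneg _) ?_ h1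
  filter_upwards [Metric.ball_mem_nhds φ one_pos] with ψ hψ
  refine hκ ψ φ ?_ (by linarith)
  rw [Metric.mem_ball, dist_eq_norm] at hψ
  linarith [norm_le_norm_add_norm_sub' ψ φ]

theorem A_apply (x : X n η) (h : x ∈ (A n η).domain) :
    A n η ⟨x, h⟩ = WithLp.toLp 1 (-(BUC.derivL ⟨x.snd, h.2⟩ BUC.endpoint),
      BUC.derivL ⟨x.snd, h.2⟩) := rfl

/-- The second component of the mild equation is the integrated transport equation. The first
identifies the derivative at `0` of the integrated trajectory with `∫ f(v)`, and evaluating the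
second at the endpoint turns this into `v(t)(0) = φ(0) + ∫ f(v)`. Conversely, the integral of a
trajectory is `C¹` with derivative `v t - v 0`. -/
theorem isMildSolution_iff
    {f : BUC η (EuclideanSpace ℝ (Fin n)) → EuclideanSpace ℝ (Fin n)} (hf : Continuous f)
    {x : X n η} (hx : x.fst = 0) {τ : ℝ} {v : ℝ → X n η} :
    IsMildSolution f x τ v ↔ (∀ t ∈ Icc 0 τ, (v t).fst = 0) ∧
      IsDelaySolution f x.snd τ fun t => (v t).snd := by
  have hsnd : ContinuousOn v (Icc 0 τ) → ContinuousOn (fun t => (v t).snd) (Icc 0 τ) := fun h =>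
    (WithLp.sndL 1 ℝ _ _).continuous.comp_continuousOn h
  have hF : ContinuousOn v (Icc 0 τ) → ContinuousOn (fun t => F f (v t)) (Icc 0 τ) := fun h =>
    (WithLp.prod_continuous_toLp 1 _ _).comp_continuousOn
      ((hf.comp_continuousOn (hsnd h)).prodMk continuousOn_const)
  have hint : ∀ {G : Type} [NormedAddCommGroup G] {u : ℝ → G}, ContinuousOn u (Icc 0 τ) →
      ∀ t ∈ Icc 0 τ, IntervalIntegrable u volume 0 t := by
    intro G _ u hu t ht
    refine (hu.mono ?_).intervalIntegrable
    rw [uIcc_of_le ht.1]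
    exact Icc_subset_Icc_right ht.2
  have hIs : ContinuousOn v (Icc 0 τ) → ∀ t ∈ Icc 0 τ,
      (∫ s in (0 : ℝ)..t, v s).snd = ∫ s in (0 : ℝ)..t, (v s).snd := fun h t ht =>
    (ContinuousLinearMap.intervalIntegral_comp_comm (WithLp.sndL 1 ℝ _ _)
      (hint h t ht)).symm
  have hFf : ContinuousOn v (Icc 0 τ) → ∀ t ∈ Icc 0 τ,
      (∫ s in (0 : ℝ)..t, F f (v s)).fst = ∫ s in (0 : ℝ)..t, f (v s).snd := fun h t ht =>
    (ContinuousLinearMap.intervalIntegral_comp_comm (WithLp.fstL 1 ℝ _ _)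
      (hint (hF h) t ht)).symm
  have hFs : ContinuousOn v (Icc 0 τ) → ∀ t ∈ Icc 0 τ,
      (∫ s in (0 : ℝ)..t, F f (v s)).snd = 0 := fun h t ht =>
    (ContinuousLinearMap.intervalIntegral_comp_comm (WithLp.sndL 1 ℝ _ _)
      (hint (hF h) t ht)).symm.trans (by simp [F])
  constructor
  · intro h
    have hfst : ∀ t ∈ Icc 0 τ, (v t).fst = 0 := fun t ht => mem_X₀_iff.mp (h.mem t ht)
    have hvc := h.continuousOn
    have hs : ∀ t ∈ Icc 0 τ, ∃ hm : (∫ s in (0 : ℝ)..t, (v s).snd) ∈ BUC.C1 η _,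
        (v t).snd = x.snd + BUC.derivL ⟨_, hm⟩ ∧
        BUC.derivL ⟨_, hm⟩ BUC.endpoint = ∫ s in (0 : ℝ)..t, f (v s).snd := by
      intro t ht
      obtain ⟨hm, he⟩ := h.eq t ht
      rw [A_apply] at he
      have h1 := congrArg WithLp.fst he
      have h2 := congrArg WithLp.snd he
      simp only [WithLp.add_fst, WithLp.add_snd, hFf hvc t ht, hFs hvc t ht, hfst t ht, hx] at h1 h2
      have hm2 := hm.2
      simp only [hIs hvc t ht] at h1 h2 hm2
      refine ⟨hm2, by simpa using h2, ?_⟩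
      rw [zero_add] at h1
      exact (neg_add_eq_zero.mp h1.symm)
    refine ⟨hfst, hsnd hvc, ?_⟩
    refine apply_eq_orbit_of_transport (hsnd hvc) (fun t ht => ?_) fun t ht => ?_
    · obtain ⟨hm, h1, -⟩ := hs t ht
      exact ⟨hm, h1⟩
    · obtain ⟨hm, h1, h2⟩ := hs t ht
      rw [← h2]
      exact congrArg (fun ψ : BUC η (EuclideanSpace ℝ (Fin n)) => ψ BUC.endpoint) h1
  · rintro ⟨hfst, hd⟩
    have hvc : ContinuousOn v (Icc 0 τ) := by
      have h1 : ContinuousOn (fun t => (WithLp.toLp 1 (0, (v t).snd) : X n η)) (Icc 0 τ) :=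
        (WithLp.prod_continuous_toLp 1 _ _).comp_continuousOn
          (continuousOn_const.prodMk hd.continuousOn)
      refine h1.congr fun t ht => ?_
      rw [← hfst t ht]; rfl
    refine ⟨hvc, fun t ht => mem_X₀_iff.mpr (hfst t ht), fun t ht => ?_⟩
    have hgc : ContinuousOn (fun s => f (v s).snd) (Icc 0 τ) := hf.comp_continuousOn (hsnd hvc)
    have hτ : 0 ≤ τ := ht.1.trans ht.2
    have hge : EqOn (fun s => f (v s).snd)
        (IccExtend hτ (domRestrict (Icc 0 τ) fun s => f (v s).snd)) (Icc 0 τ) := fun s hs =>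
      (IccExtend_of_mem hτ (domRestrict (Icc 0 τ) fun s => f (v s).snd) hs).symm
    have huc := continuous_orbit x.snd
      ((continuousOn_iff_continuous_domRestrict.mp hgc).Icc_extend' (h := hτ))
    obtain ⟨hm, hderiv⟩ := BUC.integral_mem_C1 huc ht.1
      (hd.continuousOn.mono (Icc_subset_Icc_right ht.2)) fun s hs θ => by
        have hθ : (θ : ℝ) ≤ 0 := θ.2
        rw [hd.apply_eq s ⟨hs.1, hs.2.trans ht.2⟩ θ]
        exact orbit_congr _ hge (by linarith [hs.2, ht.2])
    have hfst0 : (∫ s in (0 : ℝ)..t, v s).fst = 0 := by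
      refine (ContinuousLinearMap.intervalIntegral_comp_comm
        (WithLp.fstL 1 ℝ (EuclideanSpace ℝ (Fin n)) (BUC η (EuclideanSpace ℝ (Fin n))))
        (hint hvc t ht)).symm.trans ?_
      refine (intervalIntegral.integral_congr (g := fun _ => 0) fun s hs => ?_).trans
        intervalIntegral.integral_zero
      rw [uIcc_of_le ht.1] at hs
      exact hfst s ⟨hs.1, hs.2.trans ht.2⟩
    have hdom : (∫ s in (0 : ℝ)..t, v s) ∈ (A n η).domain := ⟨hfst0, by rwa [hIs hvc t ht]⟩
    have hder : BUC.derivL ⟨(∫ s in (0 : ℝ)..t, v s).snd, hdom.2⟩ = (v t).snd - (v 0).snd := by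
      rw [← hderiv]
      congr 2
      exact hIs hvc t ht
    have hv0 : (v 0).snd = x.snd := hd.apply_zero hτ
    refine ⟨hdom, ?_⟩
    rw [A_apply, hder, hv0]
    refine WithLp.ofLp_injective 1 (Prod.ext ?_ ?_)
    · change (v t).fst = x.fst + -((v t).snd - x.snd) BUC.endpoint +
        (∫ s in (0 : ℝ)..t, F f (v s)).fst
      rw [hFf hvc t ht, hfst t ht, hx, BUC.coe_sub, Pi.sub_apply]
      have := hd.apply_endpoint ht
      rw [this]
      abel
    · change (v t).snd = x.snd + ((v t).snd - x.snd) + (∫ s in (0 : ℝ)..t, F f (v s)).snd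
      rw [hFs hvc t ht]
      abel

end InfiniteDelay

namespace InfiniteDelay

open Set Filter Topology MeasureTheory

/-! ### Auxiliary results on bounded operators and Fourier coefficients -/

/-- For a compact perturbation of a strict contraction, the spectrum outside the open unit disc
consists of eigenvalues. -/
theorem exists_eigenvector_of_mem_spectrum {V : Type*} [NormedAddCommGroup V] [NormedSpace ℂ V]
    [CompleteSpace V] {T S : V →L[ℂ] V} (hS : ‖S‖ < 1)
    (hK : IsCompactOperator (T - S : V →L[ℂ] V)) {μ : ℂ} (hμ : 1 ≤ ‖μ‖) (h : μ ∈ spectrum ℂ T) :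
    ∃ x : V, x ≠ 0 ∧ T x = μ • x := by
  have h1 : μ ∈ resolventSet ℂ S := by
    refine spectrum.mem_resolventSet_of_norm_lt_mul ?_
    calc ‖S‖ * ‖(1 : V →L[ℂ] V)‖ ≤ ‖S‖ * 1 := by
          gcongr; exact ContinuousLinearMap.norm_id_le
      _ < ‖μ‖ := by linarith
  obtain ⟨u, hu⟩ := h1
  -- With `u = μ - S`, invertible because `‖S‖ < 1 ≤ |μ|`, one has `μ - T = u (1 - R)` with `R`
  -- compact. The Fredholm alternative for `R` at `1` decides.
  set R : V →L[ℂ] V := ↑u⁻¹ * (T - S) with hR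
  have hRc : IsCompactOperator R := hK.clm_comp (↑u⁻¹ : V →L[ℂ] V)
  rcases hRc.hasEigenvalue_or_mem_resolventSet one_ne_zero with he | hr
  · obtain ⟨x, hx⟩ := he.exists_hasEigenvector
    refine ⟨x, hx.2, ?_⟩
    have h2 : R x = x := by simpa using hx.apply_eq_smul
    have h3 : (u : V →L[ℂ] V) (R x) = (T - S) x := by
      rw [hR, ← mul_apply_eq_comp, ← mul_assoc, Units.mul_inv, one_mul]
    rw [h2, hu] at h3
    simp only [sub_apply, Algebra.algebraMap_eq_smul_one,
      smul_apply, one_apply_eq_self] at h3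
    exact (sub_left_inj.mp h3).symm
  · refine absurd ?_ h
    have h2 : algebraMap ℂ (V →L[ℂ] V) μ - T = u * (algebraMap ℂ (V →L[ℂ] V) 1 - R) := by
      rw [mul_sub, hR, ← mul_assoc, Units.mul_inv, one_mul, map_one, mul_one, hu]
      abel
    change IsUnit _
    rw [h2]
    exact u.isUnit.mul hr

/-- If the spectrum is contained in the open unit disc, then the powers tend to zero. -/
theorem exists_norm_pow_le {V : Type*} [NormedAddCommGroup V] [NormedSpace ℂ V]
    [CompleteSpace V] {T : V →L[ℂ] V} (h : ∀ μ ∈ spectrum ℂ T, ‖μ‖ < 1) {c : ℝ} (hc : 0 < c) :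
    ∃ m : ℕ, 0 < m ∧ ‖T ^ m‖ ≤ c := by
  -- On the zero space the spectrum is empty and the spectral radius argument does not apply.
  rcases subsingleton_or_nontrivial V with hV | hV
  · refine ⟨1, one_pos, ?_⟩
    rw [Subsingleton.elim (T ^ 1) 0, norm_zero]
    exact hc.le
  have h1 : spectralRadius ℂ T < (1 : ℝ≥0) :=
    spectrum.spectralRadius_lt_of_forall_lt_of_nonempty (spectrum.nonempty T) fun μ hμ => h μ hμ
  -- By Gelfand's formula `‖T ^ m‖ ≤ q ^ m` for large `m`, for any `q` between the spectral radius
  -- and `1`.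
  obtain ⟨q, hq1, hq2⟩ := ENNReal.lt_iff_exists_nnreal_btwn.mp h1
  have hq : (q : ℝ) < 1 := by exact_mod_cast hq2
  have h2 := (spectrum.pow_nnnorm_pow_one_div_tendsto_nhds_spectralRadius T).eventually_lt_const hq1
  have h3 := (tendsto_pow_atTop_nhds_zero_of_lt_one q.coe_nonneg hq).eventually_lt_const hc
  obtain ⟨m, hm, hm3, hm0⟩ := (h2.and (h3.and (eventually_gt_atTop 0))).exists
  refine ⟨m, hm0, le_trans ?_ hm3.le⟩
  have h4 : (‖T ^ m‖₊ : ℝ≥0∞) ≤ (q : ℝ≥0∞) ^ m := by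
    have h5 := ENNReal.rpow_le_rpow hm.le (Nat.cast_nonneg (α := ℝ) m)
    rwa [← ENNReal.rpow_mul, one_div_mul_cancel (by positivity), ENNReal.rpow_one,
      ENNReal.rpow_natCast] at h5
  exact_mod_cast h4

/-- A continuous `1`-periodic function not vanishing at `0` has a nonzero Fourier coefficient. -/
theorem exists_integral_exp_mul_ne_zero {h : ℝ → ℂ} (hc : ContinuousOn h (Icc 0 1))
    (hp : h 0 = h 1) (h0 : h 0 ≠ 0) :
    ∃ k : ℤ, ∫ x in (0 : ℝ)..1, Complex.exp (-(2 * Real.pi * Complex.I * k) * x) * h x ≠ 0 := by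
  by_contra! hall
  set F : C(AddCircle (1 : ℝ), ℂ) :=
    ⟨AddCircle.liftIco 1 0 h, AddCircle.liftIco_zero_continuous hp hc⟩ with hF
  have hzero : ∀ k : ℤ, fourierCoeff F k = 0 := by
    intro k
    have h1 : fourierCoeff F k = fourierCoeff (AddCircle.liftIco 1 0 h) k := rfl
    rw [h1, fourierCoeff_liftIco_eq, fourierCoeffOn_eq_integral, smul_eq_zero]
    right
    have h2 := hall k
    simp only [zero_add]
    rw [← h2]
    refine intervalIntegral.integral_congr fun x _ => ?_
    simp only [smul_eq_mul]
    rw [fourier_coe_apply]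
    congr 2
    push_cast
    ring
  -- Vanishing coefficients are summable, so the Fourier series converges pointwise to the function,
  -- which forces `h 0 = 0`.
  have hs : Summable (fourierCoeff F) := by
    rw [show fourierCoeff F = fun _ => 0 from funext hzero]
    exact summable_zero
  have h1 := has_pointwise_sum_fourier_series_of_summable hs ((0 : ℝ) : AddCircle (1 : ℝ))
  simp only [hzero, zero_smul] at h1
  have h2 : F ((0 : ℝ) : AddCircle (1 : ℝ)) = h 0 :=
    AddCircle.liftIco_zero_coe_apply (by simp)
  rw [h2] at h1
  exact h0 (h1.unique hasSum_zero)

/-- Periodicity is assumed on the half-line only, because the semigroup runs forward in time. -/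
theorem integral_add_one_eq {V : Type*} [NormedAddCommGroup V] [NormedSpace ℝ V] {h : ℝ → V}
    (hc : Continuous h) (hp : ∀ r, 0 ≤ r → h (r + 1) = h r) {t : ℝ} (ht : 0 ≤ t) :
    ∫ s in t..t + 1, h s = ∫ s in (0 : ℝ)..1, h s := by
  have hii : ∀ a b, IntervalIntegrable h volume a b := fun a b => hc.intervalIntegrable a b
  have h1 : ∫ s in (1 : ℝ)..t + 1, h s = ∫ s in (0 : ℝ)..t, h s := by
    have h2 := intervalIntegral.integral_comp_add_right h (a := 0) (b := t) 1
    rw [zero_add] at h2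
    rw [← h2]
    refine intervalIntegral.integral_congr fun s hs => ?_
    rw [uIcc_of_le ht] at hs
    exact hp s hs.1
  have h3 := intervalIntegral.integral_add_adjacent_intervals (hii 0 t) (hii t (t + 1))
  have h4 := intervalIntegral.integral_add_adjacent_intervals (hii 0 1) (hii 1 (t + 1))
  rw [h1] at h4
  rw [← h4, add_comm] at h3
  exact add_right_cancel h3

/-! ### Complex scalars -/

namespace BUC

variable {η : ℝ} {E : Type*} [NormedAddCommGroup E] [NormedSpace ℝ E] [NormedSpace ℂ E]
  [IsScalarTower ℝ ℂ E]

instance : SMul ℂ (BUC η E) where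
  smul c φ := mk (c • ⇑φ) <| by
    obtain ⟨h1, ⟨C, hC⟩, h2⟩ := φ.mem
    have h : (fun θ : Iic (0 : ℝ) => Real.exp (η * θ) • (c • ⇑φ) θ)
        = c • fun θ : Iic (0 : ℝ) => Real.exp (η * θ) • φ θ :=
      funext fun θ => smul_comm _ _ _
    refine ⟨h1.const_smul c, ⟨‖c‖ * C, fun θ => ?_⟩, ?_⟩
    · rw [Pi.smul_apply, smul_comm, norm_smul]
      exact mul_le_mul_of_nonneg_left (hC θ) (norm_nonneg _)
    · rw [h]
      exact h2.const_smul c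

@[simp] theorem coe_complex_smul (c : ℂ) (φ : BUC η E) : ⇑(c • φ) = c • ⇑φ := rfl

instance : Module ℂ (BUC η E) where
  one_smul φ := DFunLike.ext _ _ fun θ => one_smul ℂ (φ θ)
  mul_smul c d φ := DFunLike.ext _ _ fun θ => mul_smul c d (φ θ)
  smul_zero c := DFunLike.ext _ _ fun _ => smul_zero c
  smul_add c φ ψ := DFunLike.ext _ _ fun θ => smul_add c (φ θ) (ψ θ)
  add_smul c d φ := DFunLike.ext _ _ fun θ => add_smul c d (φ θ)
  zero_smul φ := DFunLike.ext _ _ fun θ => zero_smul ℂ (φ θ)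

instance : IsScalarTower ℝ ℂ (BUC η E) where
  smul_assoc r c φ := DFunLike.ext _ _ fun θ => smul_assoc r c (φ θ)

instance : NormedSpace ℂ (BUC η E) where
  norm_smul_le c φ := norm_le _ fun θ => by
    rw [coe_complex_smul, Pi.smul_apply, norm_smul, mul_left_comm]
    exact mul_le_mul_of_nonneg_left (weight_le_norm φ θ) (norm_nonneg c)

end BUC

/-! ### The semigroup of a linear delay equation -/

section Semigroup

variable {η : ℝ} {E : Type*} [NormedAddCommGroup E] [NormedSpace ℝ E] [NormedSpace ℂ E]
  [IsScalarTower ℝ ℂ E]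

namespace IsDelaySolution

variable {L : BUC η E →L[ℂ] E} {φ ψ : BUC η E} {τ : ℝ} {v w : ℝ → BUC η E}

/-- Superposition; together with uniqueness it makes the solution operators linear. -/
theorem add (hv : IsDelaySolution L φ τ v) (hw : IsDelaySolution L ψ τ w) :
    IsDelaySolution L (φ + ψ) τ fun t => v t + w t := by
  refine ⟨hv.continuousOn.add hw.continuousOn, fun t ht θ => ?_⟩
  have hθ : (θ : ℝ) ≤ 0 := θ.2
  have hint : ∀ {v}, ContinuousOn v (Icc 0 τ) →
      IntervalIntegrable (fun s => L (v s)) volume 0 (max (t + θ) 0) := fun {v} h => by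
    refine ((L.continuous.comp_continuousOn h).mono ?_).intervalIntegrable
    rw [uIcc_of_le (le_max_right _ _)]
    exact Icc_subset_Icc_right (max_le (by linarith [ht.2]) (ht.1.trans ht.2))
  simp only [BUC.coe_add, Pi.add_apply, hv.apply_eq t ht, hw.apply_eq t ht, orbit, map_add]
  rw [intervalIntegral.integral_add (hint hv.continuousOn) (hint hw.continuousOn)]
  abel

theorem smul (c : ℂ) (hv : IsDelaySolution L φ τ v) :
    IsDelaySolution L (c • φ) τ fun t => c • v t := by
  refine ⟨hv.continuousOn.const_smul c, fun t ht θ => ?_⟩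
  simp only [BUC.coe_complex_smul, Pi.smul_apply, hv.apply_eq t ht, orbit, map_smul]
  rw [intervalIntegral.integral_smul, smul_add]

end IsDelaySolution

variable [CompleteSpace E]

/-- The trajectory in `BUC_η` of the solution of `u'(t) = L u_t` with past `φ`. -/
def linearTrajectory (hη : 0 ≤ η) (L : BUC η E →L[ℂ] E) (φ : BUC η E) : ℝ → BUC η E :=
  (exists_isDelaySolution hη L.lipschitz (map_zero L) φ).choose

theorem continuous_linearTrajectory (hη : 0 ≤ η) (L : BUC η E →L[ℂ] E) (φ : BUC η E) :
    Continuous (linearTrajectory hη L φ) :=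
  (exists_isDelaySolution hη L.lipschitz (map_zero L) φ).choose_spec.1

theorem isDelaySolution_linearTrajectory (hη : 0 ≤ η) (L : BUC η E →L[ℂ] E) (φ : BUC η E)
    (τ : ℝ) : IsDelaySolution L φ τ (linearTrajectory hη L φ) :=
  (exists_isDelaySolution hη L.lipschitz (map_zero L) φ).choose_spec.2 τ

theorem eq_linearTrajectory (hη : 0 ≤ η) {L : BUC η E →L[ℂ] E} {φ : BUC η E} {τ : ℝ}
    {v : ℝ → BUC η E} (hv : IsDelaySolution L φ τ v) {t : ℝ} (ht : t ∈ Icc 0 τ) :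
    v t = linearTrajectory hη L φ t :=
  IsDelaySolution.eqOn hη (fun _ _ => ⟨‖L‖, fun φ ψ _ _ => by
    rw [← map_sub]; exact L.le_opNorm _⟩) L.continuous hv
    (isDelaySolution_linearTrajectory hη L φ τ) ht

/-- The solution operator at time `t⁺` of `u'(t) = L u_t`. -/
def semigroup (hη : 0 ≤ η) (L : BUC η E →L[ℂ] E) (t : ℝ) : BUC η E →L[ℂ] BUC η E :=
  LinearMap.mkContinuous
    { toFun := fun φ => linearTrajectory hη L φ (max t 0)
      map_add' := fun φ ψ => (eq_linearTrajectory hη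
        ((isDelaySolution_linearTrajectory hη L φ _).add (isDelaySolution_linearTrajectory hη L ψ _))
        (right_mem_Icc.mpr (le_max_right t 0))).symm
      map_smul' := fun c φ => (eq_linearTrajectory hη
        ((isDelaySolution_linearTrajectory hη L φ _).smul c)
        (right_mem_Icc.mpr (le_max_right t 0))).symm }
    (Real.exp (‖L‖ * max t 0)) fun φ => by
      rw [mul_comm]
      exact (isDelaySolution_linearTrajectory hη L φ (max t 0)).norm_le hη (norm_nonneg L)
        (fun s _ => L.le_opNorm _) _ (right_mem_Icc.mpr (le_max_right t 0))

variable (hη : 0 ≤ η) (L : BUC η E →L[ℂ] E)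

theorem semigroup_apply {t : ℝ} (ht : 0 ≤ t) (φ : BUC η E) :
    semigroup hη L t φ = linearTrajectory hη L φ t := by
  change linearTrajectory hη L φ (max t 0) = _
  rw [max_eq_left ht]

theorem norm_semigroup_apply_le {t : ℝ} (ht : 0 ≤ t) (φ : BUC η E) :
    ‖semigroup hη L t φ‖ ≤ ‖φ‖ * Real.exp (‖L‖ * t) := by
  rw [semigroup_apply hη L ht]
  exact (isDelaySolution_linearTrajectory hη L φ t).norm_le hη (norm_nonneg L)
    (fun s _ => L.le_opNorm _) _ (right_mem_Icc.mpr ht)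

theorem continuous_semigroup_apply (φ : BUC η E) : Continuous fun t => semigroup hη L t φ :=
  (continuous_linearTrajectory hη L φ).comp (by fun_prop : Continuous fun t : ℝ => max t 0)

theorem isDelaySolution_semigroup (φ : BUC η E) (τ : ℝ) :
    IsDelaySolution L φ τ fun t => semigroup hη L t φ :=
  (isDelaySolution_linearTrajectory hη L φ τ).congr
    (fun _ ht => (semigroup_apply hη L ht.1 φ).symm) fun _ _ => rfl

theorem semigroup_add {s t : ℝ} (hs : 0 ≤ s) (ht : 0 ≤ t) (φ : BUC η E) :
    semigroup hη L t (semigroup hη L s φ) = semigroup hη L (s + t) φ := by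
  rw [semigroup_apply hη L ht]
  exact (eq_linearTrajectory hη ((isDelaySolution_semigroup hη L φ (s + t)).translate L.continuous hs ht
    le_rfl) (right_mem_Icc.mpr ht)).symm

theorem semigroup_zero (φ : BUC η E) : semigroup hη L 0 φ = φ :=
  (isDelaySolution_semigroup hη L φ 0).apply_zero le_rfl

theorem semigroup_pow (m : ℕ) : semigroup hη L 1 ^ m = semigroup hη L m := by
  induction m with
  | zero => ext1 φ; rw [Nat.cast_zero, semigroup_zero, pow_zero, one_apply_eq_self]
  | succ k ih =>
    ext1 φ
    rw [pow_succ', mul_apply_eq_comp, ih, semigroup_add hη L k.cast_nonneg zero_le_one,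
      Nat.cast_succ]

theorem semigroup_apply_endpoint {t : ℝ} (ht : 0 ≤ t) (φ : BUC η E) :
    semigroup hη L t φ BUC.endpoint =
      φ BUC.endpoint + ∫ s in (0 : ℝ)..t, L (semigroup hη L s φ) :=
  (isDelaySolution_semigroup hη L φ t).apply_endpoint (right_mem_Icc.mpr ht)

/-- A common eigenvector of the semigroup is an exponential function. -/
theorem eigenfunction_of_forall_semigroup {c : BUC η E} {z : ℂ}
    (h : ∀ t : ℝ, 0 ≤ t → semigroup hη L t c = Complex.exp (z * t) • c) :
    (∀ θ : Iic (0 : ℝ), c θ = Complex.exp (z * (θ : ℝ)) • c BUC.endpoint) ∧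
      z • c BUC.endpoint = L c := by
  constructor
  · intro θ
    have hθ : (θ : ℝ) ≤ 0 := θ.2
    -- At time `-θ` the history at `θ` is the original value at `0`, so `c(0) = e^{-zθ} c(θ)`.
    have h1 := congrArg (fun ψ : BUC η E => ψ θ) (h (-θ) (by linarith))
    simp only [BUC.coe_complex_smul, Pi.smul_apply] at h1
    rw [(isDelaySolution_semigroup hη L c (-θ)).apply_eq _ (right_mem_Icc.mpr (by linarith)),
      neg_add_cancel, orbit_of_nonpos _ _ le_rfl] at h1
    have h2 : c BUC.endpoint = Complex.exp (z * (-θ : ℝ)) • c θ := h1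
    rw [h2, smul_smul, ← Complex.exp_add]
    simp
  · have hexp : ∀ t : ℝ, HasDerivAt (fun t : ℝ => Complex.exp (z * t)) (Complex.exp (z * t) * z) t := by
      intro t
      have h1 : HasDerivAt (fun t : ℝ => z * t) z t := by
        simpa using (Complex.ofRealCLM.hasDerivAt (x := t)).const_mul z
      exact h1.cexp
    have h1 : HasDerivAt (fun t : ℝ => Complex.exp (z * t) • c BUC.endpoint)
        (z • c BUC.endpoint) 0 := by
      simpa using (hexp 0).smul_const (c BUC.endpoint)
    have hc : Continuous fun s : ℝ => Complex.exp (z * s) • L c := by fun_prop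
    have h2 : HasDerivAt (fun t : ℝ => c BUC.endpoint + ∫ s in (0 : ℝ)..t, Complex.exp (z * s) • L c)
        (L c) 0 := by
      simpa using ((hc.integral_hasStrictDerivAt 0 0).hasDerivAt).const_add (c BUC.endpoint)
    have heq : ∀ t ∈ Ici (0 : ℝ), Complex.exp (z * t) • c BUC.endpoint =
        c BUC.endpoint + ∫ s in (0 : ℝ)..t, Complex.exp (z * s) • L c := by
      intro t ht
      have h3 := semigroup_apply_endpoint hη L ht c
      rw [h t ht] at h3
      change Complex.exp (z * t) • c BUC.endpoint = _ at h3
      rw [h3]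
      congr 1
      refine intervalIntegral.integral_congr fun s hs => ?_
      rw [uIcc_of_le ht] at hs
      simp only [h s hs.1, map_smul]
    -- The two expressions for the value at the endpoint agree for `t ≥ 0`; their right derivatives
    -- at `0` are compared.
    exact (uniqueDiffOn_Ici 0 0 self_mem_Ici).eq_deriv _
      (h1.hasDerivWithinAt) (h2.hasDerivWithinAt.congr heq (heq 0 self_mem_Ici))

/-- An eigenvalue of the time-one map gives a characteristic value. -/
theorem exists_eigenfunction {φ : BUC η E} (hφ : φ ≠ 0) {μ : ℂ} (hμ : 1 ≤ ‖μ‖)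
    (h : semigroup hη L 1 φ = μ • φ) :
    ∃ (z : ℂ) (c : BUC η E), 0 ≤ z.re ∧ c BUC.endpoint ≠ 0 ∧
      (∀ θ : Iic (0 : ℝ), c θ = Complex.exp (z * (θ : ℝ)) • c BUC.endpoint) ∧
      z • c BUC.endpoint = L c := by
  have hμ0 : μ ≠ 0 := norm_pos_iff.mp (by linarith)
  obtain ⟨θ, hθ⟩ : ∃ θ, φ θ ≠ 0 := by
    by_contra! h0
    exact hφ (DFunLike.ext _ _ h0)
  obtain ⟨ℓ, hℓ⟩ := SeparatingDual.exists_ne_zero (R := ℂ) hθ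
  have hexp : ∀ z : ℂ, Continuous fun s : ℝ => Complex.exp (z * s) := fun z => by fun_prop
  -- The scalar function `μ^{-s} ℓ(T(s)φ(θ))` takes equal values at `0` and `1`, since `T(1)φ = μφ`.
  set h1 : ℝ → ℂ := fun s => Complex.exp (-Complex.log μ * s) * ℓ (semigroup hη L s φ θ) with hh1
  have hTθ : Continuous fun s => semigroup hη L s φ θ :=
    (BUC.evalL η E θ).continuous.comp (continuous_semigroup_apply hη L φ)
  have hc1 : Continuous h1 := (hexp _).mul (ℓ.continuous.comp hTθ)
  obtain ⟨k, hk⟩ := exists_integral_exp_mul_ne_zero (h := h1) hc1.continuousOn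
    (by
      simp only [hh1, semigroup_zero, h, BUC.coe_complex_smul, Pi.smul_apply, map_smul, smul_eq_mul,
        Complex.ofReal_zero, Complex.ofReal_one, mul_zero, mul_one, Complex.exp_zero, one_mul]
      rw [← mul_assoc, Complex.exp_neg, Complex.exp_log hμ0, inv_mul_cancel₀ hμ0, one_mul])
    (by simpa [hh1, semigroup_zero] using hℓ)
  -- Among the logarithms of `μ`, the one shifted by `2πik` makes the integral `c` below the `k`-th
  -- Fourier coefficient of `μ^{-s} T(s)φ`; the choice of `k` gives `c θ ≠ 0`.
  set z : ℂ := Complex.log μ + 2 * Real.pi * Complex.I * k with hz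
  set g : ℝ → BUC η E := fun s => Complex.exp (-z * s) • semigroup hη L s φ with hg
  have hgc : Continuous g := (hexp _).smul (continuous_semigroup_apply hη L φ)
  have hez : Complex.exp (-z) * μ = 1 := by
    have h2 : Complex.exp (2 * Real.pi * Complex.I * k) = 1 := by
      rw [mul_comm]; exact Complex.exp_int_mul_two_pi_mul_I k
    rw [Complex.exp_neg, hz, Complex.exp_add, Complex.exp_log hμ0, h2, mul_one, inv_mul_cancel₀ hμ0]
  have hgp : ∀ r, 0 ≤ r → g (r + 1) = g r := by
    intro r hr
    simp only [hg]
    rw [add_comm r 1, ← semigroup_add hη L zero_le_one hr, h, map_smul, smul_smul]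
    congr 1
    push_cast
    rw [mul_add, mul_one, Complex.exp_add, mul_right_comm, hez, one_mul]
  set c : BUC η E := ∫ s in (0 : ℝ)..1, g s with hc
  have hcθ : c θ ≠ 0 := by
    intro h0
    apply hk
    have h2 := (((ℓ.restrictScalars ℝ).comp (BUC.evalL η E θ)).intervalIntegral_comp_comm
      (hgc.intervalIntegrable 0 1 (μ := volume)))
    have h3 : ((ℓ.restrictScalars ℝ).comp (BUC.evalL η E θ)) (∫ s in (0 : ℝ)..1, g s) = 0 := by
      change ℓ (c θ) = 0
      rw [h0, map_zero]
    rw [h3] at h2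
    rw [← h2]
    refine intervalIntegral.integral_congr fun s _ => ?_
    change Complex.exp (-(2 * Real.pi * Complex.I * k) * s) *
      (Complex.exp (-Complex.log μ * s) * ℓ (semigroup hη L s φ θ)) =
      ℓ (Complex.exp (-z * s) • semigroup hη L s φ θ)
    rw [map_smul, smul_eq_mul, ← mul_assoc, ← Complex.exp_add]
    congr 2
    rw [hz]
    ring
  -- `T(t)` turns the integrand into `e^{zt} g(s + t)`, and the integral of `g` over a period does
  -- not depend on where the period starts.
  have hT : ∀ t : ℝ, 0 ≤ t → semigroup hη L t c = Complex.exp (z * t) • c := by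
    intro t ht
    have h2 := (((semigroup hη L t).restrictScalars ℝ).intervalIntegral_comp_comm
      (hgc.intervalIntegrable 0 1 (μ := volume)))
    have h3 : semigroup hη L t c = ∫ s in (0 : ℝ)..1, semigroup hη L t (g s) := h2.symm
    have h4 : ∫ s in (0 : ℝ)..1, semigroup hη L t (g s) =
        ∫ s in (0 : ℝ)..1, Complex.exp (z * t) • g (s + t) := by
      refine intervalIntegral.integral_congr fun s hs => ?_
      rw [uIcc_of_le zero_le_one] at hs
      simp only [hg, map_smul]
      rw [semigroup_add hη L hs.1 ht, smul_smul, ← Complex.exp_add]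
      congr 2
      push_cast
      ring
    rw [h3, h4, intervalIntegral.integral_smul, intervalIntegral.integral_comp_add_right g,
      zero_add, add_comm 1 t, integral_add_one_eq hgc hgp ht]
  obtain ⟨h5, h6⟩ := eigenfunction_of_forall_semigroup hη L hT
  refine ⟨z, c, ?_, fun h0 => hcθ ?_, h5, h6⟩
  · have h7 : z.re = Real.log ‖μ‖ := by simp [hz, Complex.log_re]
    rw [h7]
    exact Real.log_nonneg hμ
  · rw [h5 θ, h0, smul_zero]

end Semigroup

end InfiniteDelay

namespace InfiniteDelay

open Set Filter Topology MeasureTheory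

/-! ### The time-one map is a compact perturbation of a contraction -/

section Compactness

variable {η : ℝ} {E : Type*} [NormedAddCommGroup E] [NormedSpace ℝ E]

/-- The past of `φ` shifted by one time unit and continued by exponential decay. -/
def shiftFun (φ : BUC η E) : BUC η E :=
  BUC.mk (fun θ => Real.exp (-(η * max (1 + (θ : ℝ)) 0)) • φ (clip (1 + θ))) <| by
    have key : ∀ θ : Iic (0 : ℝ), Real.exp (η * θ) •
        Real.exp (-(η * max (1 + (θ : ℝ)) 0)) • φ (clip (1 + θ)) =
        Real.exp (-η) • Real.exp (η * clip (1 + θ)) • φ (clip (1 + θ)) := by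
      intro θ
      rw [smul_smul, smul_smul, ← Real.exp_add, ← Real.exp_add]
      congr 2
      have h := max_add_min (1 + (θ : ℝ)) 0
      change _ = -η + η * min (1 + (θ : ℝ)) 0
      linear_combination -η * h
    have hcl : UniformContinuous fun θ : Iic (0 : ℝ) => clip (1 + θ) :=
      lipschitzWith_clip.uniformContinuous.comp
        (uniformContinuous_const.add uniformContinuous_subtype_val)
    obtain ⟨h1, ⟨C, hC⟩, h2⟩ := φ.mem
    refine ⟨?_, ⟨Real.exp (-η) * C, fun θ => ?_⟩, ?_⟩
    · exact Continuous.smul (by fun_prop) (h1.comp hcl.continuous)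
    · rw [key, BUC.norm_weight]
      exact mul_le_mul_of_nonneg_left (hC _) (Real.exp_pos _).le
    · simp only [key]
      exact (h2.comp hcl).const_smul _

theorem shiftFun_apply (φ : BUC η E) (θ : Iic (0 : ℝ)) :
    shiftFun φ θ = Real.exp (-(η * max (1 + (θ : ℝ)) 0)) • φ (clip (1 + θ)) := rfl

/-- Since `max + min` of `1 + θ` and `0` is `1 + θ`, weight and decay factor combine to `e^{-η}`
times the weight at `min (1 + θ) 0`. The continuation is chosen so that this holds on `[-1, 0]` as
well. -/
theorem norm_shiftFun_le (φ : BUC η E) : ‖shiftFun φ‖ ≤ Real.exp (-η) * ‖φ‖ := by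
  refine BUC.norm_le _ fun θ => ?_
  have h := max_add_min (1 + (θ : ℝ)) 0
  have h1 : η * θ + -(η * max (1 + (θ : ℝ)) 0) = -η + η * min (1 + (θ : ℝ)) 0 := by
    linear_combination -η * h
  rw [shiftFun_apply, BUC.norm_weight, ← mul_assoc, ← Real.exp_add, h1, Real.exp_add, mul_assoc]
  exact mul_le_mul_of_nonneg_left (BUC.weight_le_norm φ (clip (1 + θ))) (Real.exp_pos _).le

variable (η) in
/-- Extension of a function on `[0, 1]`, transported to `[-1, 0]`, with the inverse weight. -/
def extendFun (k : BoundedContinuousFunction (Icc (0 : ℝ) 1) E) : BUC η E :=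
  BUC.mk (fun θ => Real.exp (-(η * θ)) • k (projIcc 0 1 zero_le_one (1 + θ))) <| by
    have key : ∀ θ : Iic (0 : ℝ), Real.exp (η * θ) •
        Real.exp (-(η * θ)) • k (projIcc 0 1 zero_le_one (1 + θ)) =
        k (projIcc 0 1 zero_le_one (1 + θ)) := by
      intro θ
      rw [smul_smul, ← Real.exp_add, add_neg_cancel, Real.exp_zero, one_smul]
    have hcl : UniformContinuous fun θ : Iic (0 : ℝ) =>
        projIcc (0 : ℝ) 1 zero_le_one (1 + θ) :=
      (LipschitzWith.projIcc zero_le_one).uniformContinuous.comp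
        (uniformContinuous_const.add uniformContinuous_subtype_val)
    refine ⟨Continuous.smul (by fun_prop) (k.continuous.comp hcl.continuous), ⟨‖k‖, fun θ => ?_⟩, ?_⟩
    · rw [key]
      exact k.norm_coe_le_norm _
    · simp only [key]
      exact (CompactSpace.uniformContinuous_of_continuous k.continuous).comp hcl

theorem extendFun_apply (k : BoundedContinuousFunction (Icc (0 : ℝ) 1) E) (θ : Iic (0 : ℝ)) :
    extendFun η k θ = Real.exp (-(η * θ)) • k (projIcc 0 1 zero_le_one (1 + θ)) := rfl

theorem lipschitzWith_extendFun : LipschitzWith 1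
    (extendFun η : BoundedContinuousFunction (Icc (0 : ℝ) 1) E → BUC η E) := by
  refine LipschitzWith.of_dist_le_mul fun k k' => ?_
  rw [NNReal.coe_one, one_mul, dist_eq_norm]
  refine BUC.norm_le _ fun θ => ?_
  rw [BUC.coe_sub, Pi.sub_apply, extendFun_apply, extendFun_apply, ← smul_sub, BUC.norm_weight,
    ← mul_assoc, ← Real.exp_add, add_neg_cancel, Real.exp_zero, one_mul, ← dist_eq_norm]
  exact BoundedContinuousFunction.dist_coe_le_dist _

variable [NormedSpace ℂ E] [IsScalarTower ℝ ℂ E]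

variable (η E) in
/-- `shiftFun` as a bounded operator. -/
def shiftL : BUC η E →L[ℂ] BUC η E :=
  LinearMap.mkContinuous
    { toFun := shiftFun
      map_add' := fun _ _ => DFunLike.ext _ _ fun _ => smul_add _ _ _
      map_smul' := fun _ _ => DFunLike.ext _ _ fun _ => smul_comm _ _ _ }
    (Real.exp (-η)) norm_shiftFun_le

theorem norm_shiftL_lt_one (hη : 0 < η) : ‖shiftL η E‖ < 1 :=
  (LinearMap.mkContinuous_norm_le _ (Real.exp_pos _).le _).trans_lt
    (by simpa using hη)

variable [CompleteSpace E] (hη : 0 ≤ η) (L : BUC η E →L[ℂ] E)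

/-- With `ρ = 1 + θ`, the function differentiated is the weighted difference `e^{ηθ} (u(ρ) - e^{-ηρ}
φ(0))` between the solution and the continuation used in `shiftFun`. -/
theorem hasDerivAt_weighted_endpoint (φ : BUC η E) {ρ : ℝ} :
    HasDerivAt (fun ρ => Real.exp (-η) • (Real.exp (η * ρ) •
      (φ BUC.endpoint + ∫ s in (0 : ℝ)..ρ, L (semigroup hη L s φ)) - φ BUC.endpoint))
      (Real.exp (-η) • (Real.exp (η * ρ) • L (semigroup hη L ρ φ) + (Real.exp (η * ρ) * η) •
        (φ BUC.endpoint + ∫ s in (0 : ℝ)..ρ, L (semigroup hη L s φ)))) ρ := by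
  have hc : Continuous fun s => L (semigroup hη L s φ) :=
    L.continuous.comp (continuous_semigroup_apply hη L φ)
  have h1 : HasDerivAt (fun ρ => φ BUC.endpoint + ∫ s in (0 : ℝ)..ρ, L (semigroup hη L s φ))
      (L (semigroup hη L ρ φ)) ρ := ((hc.integral_hasStrictDerivAt 0 ρ).hasDerivAt).const_add _
  have h2 : HasDerivAt (fun ρ : ℝ => Real.exp (η * ρ)) (Real.exp (η * ρ) * η) ρ := by
    simpa using ((hasDerivAt_id ρ).const_mul η).exp
  exact ((h2.smul h1).sub_const _).const_smul _

/-- The part of the trajectory on `[0, 1]` which is not accounted for by `shiftL`. -/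
def segment (φ : BUC η E) : BoundedContinuousFunction (Icc (0 : ℝ) 1) E :=
  BoundedContinuousFunction.mkOfCompact
    ⟨fun ρ => Real.exp (-η) • (Real.exp (η * ρ) •
      (φ BUC.endpoint + ∫ s in (0 : ℝ)..ρ, L (semigroup hη L s φ)) - φ BUC.endpoint), by
      have : Continuous fun ρ : ℝ => Real.exp (-η) • (Real.exp (η * ρ) •
          (φ BUC.endpoint + ∫ s in (0 : ℝ)..ρ, L (semigroup hη L s φ)) - φ BUC.endpoint) :=
        continuous_iff_continuousAt.mpr fun ρ => (hasDerivAt_weighted_endpoint hη L φ).continuousAt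
      exact this.comp continuous_subtype_val⟩

theorem segment_apply (φ : BUC η E) (ρ : Icc (0 : ℝ) 1) :
    segment hη L φ ρ = Real.exp (-η) • (Real.exp (η * ρ) •
      (φ BUC.endpoint + ∫ s in (0 : ℝ)..ρ, L (semigroup hη L s φ)) - φ BUC.endpoint) := rfl

/-- The Lipschitz constant is uniform over the unit ball. This gives equicontinuity and, as segments
vanish at `0`, boundedness. -/
theorem norm_segment_sub_le {φ : BUC η E} (hφ : ‖φ‖ ≤ 1) (ρ σ : Icc (0 : ℝ) 1) :
    ‖segment hη L φ ρ - segment hη L φ σ‖ ≤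
      (‖L‖ + η) * Real.exp ‖L‖ * ‖(ρ : ℝ) - σ‖ := by
  rw [segment_apply, segment_apply]
  refine (convex_Icc (0 : ℝ) 1).norm_image_sub_le_of_norm_hasDerivWithin_le
    (fun r _ => (hasDerivAt_weighted_endpoint hη L φ (ρ := r)).hasDerivWithinAt) (fun r hr => ?_)
    σ.2 ρ.2
  rw [← semigroup_apply_endpoint hη L hr.1, BUC.norm_weight]
  have h1 : ‖semigroup hη L r φ‖ ≤ Real.exp ‖L‖ := by
    refine (norm_semigroup_apply_le hη L hr.1 φ).trans ?_
    calc ‖φ‖ * Real.exp (‖L‖ * r) ≤ 1 * Real.exp (‖L‖ * 1) := by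
          gcongr
          exact hr.2
      _ = _ := by rw [one_mul, mul_one]
  have h2 : ‖L (semigroup hη L r φ)‖ ≤ ‖L‖ * Real.exp ‖L‖ :=
    (L.le_opNorm _).trans (by gcongr)
  have h3 : ‖semigroup hη L r φ BUC.endpoint‖ ≤ Real.exp ‖L‖ :=
    (BUC.norm_endpoint_le _).trans h1
  have h4 : Real.exp (-η) * Real.exp (η * r) ≤ 1 := by
    rw [← Real.exp_add]
    exact Real.exp_le_one_iff.mpr (by nlinarith [hr.2])
  calc _ ≤ Real.exp (-η) * (Real.exp (η * r) * (‖L‖ * Real.exp ‖L‖) +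
        Real.exp (η * r) * η * Real.exp ‖L‖) := by
        gcongr
        refine (norm_add_le _ _).trans (add_le_add ?_ ?_)
        · rw [BUC.norm_weight]
          gcongr
        · rw [norm_smul, Real.norm_of_nonneg (by positivity)]
          gcongr
    _ = Real.exp (-η) * Real.exp (η * r) * ((‖L‖ + η) * Real.exp ‖L‖) := by ring
    _ ≤ 1 * ((‖L‖ + η) * Real.exp ‖L‖) := by gcongr
    _ = _ := one_mul _

theorem segment_zero (φ : BUC η E) : segment hη L φ ⟨0, left_mem_Icc.mpr zero_le_one⟩ = 0 := by
  rw [segment_apply]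
  simp

/-- For `θ ≤ -1` both operators give `φ (1 + θ)`, so the difference is carried by `[-1, 0]`. -/
theorem semigroup_one_sub_shiftL (φ : BUC η E) :
    (semigroup hη L 1 - shiftL η E) φ = extendFun η (segment hη L φ) := by
  refine DFunLike.ext _ _ fun θ => ?_
  have hθ : (θ : ℝ) ≤ 0 := θ.2
  change semigroup hη L 1 φ θ - shiftFun φ θ = _
  rw [(isDelaySolution_semigroup hη L φ 1).apply_eq 1 (right_mem_Icc.mpr zero_le_one),
    shiftFun_apply, extendFun_apply]
  rcases le_total (1 + (θ : ℝ)) 0 with h | h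
  · rw [orbit_of_nonpos _ _ h, projIcc_of_le_left zero_le_one h, segment_zero, clip_of_nonpos h,
      max_eq_right h]
    simp
  · rw [orbit_of_nonneg _ _ h, projIcc_of_mem zero_le_one ⟨h, by linarith⟩, segment_apply,
      clip_of_nonneg h, max_eq_left h, smul_sub, smul_sub, smul_smul, smul_smul, smul_smul,
      ← Real.exp_add, ← Real.exp_add]
    congr 1
    · have h1 : -(η * (θ : ℝ)) + -η + η * (1 + θ) = 0 := by ring
      rw [h1, Real.exp_zero, one_smul]
    · congr 2
      ring

/-- Arzelà–Ascoli makes the segments of the unit ball relatively compact, and `extendFun` is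
continuous, so it carries the compact closure to a compact set. -/
theorem isCompactOperator_semigroup_one_sub [ProperSpace E] :
    IsCompactOperator (semigroup hη L 1 - shiftL η E : BUC η E →L[ℂ] BUC η E) := by
  set C : ℝ≥0 := ⟨(‖L‖ + η) * Real.exp ‖L‖, by positivity⟩ with hC
  set 𝒜 : Set (BoundedContinuousFunction (Icc (0 : ℝ) 1) E) :=
    segment hη L '' Metric.closedBall 0 1
  have hLip : ∀ k : 𝒜, LipschitzWith C (k : BoundedContinuousFunction (Icc (0 : ℝ) 1) E) := by
    rintro ⟨_, φ, hφ, rfl⟩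
    refine LipschitzWith.of_dist_le_mul fun ρ σ => ?_
    rw [dist_eq_norm]
    exact norm_segment_sub_le hη L (mem_closedBall_zero_iff.mp hφ) ρ σ
  have hcomp : IsCompact (closure 𝒜) := by
    refine BoundedContinuousFunction.arzela_ascoli (Metric.closedBall 0 C)
      (isCompact_closedBall 0 (C : ℝ)) 𝒜 ?_
      (LipschitzWith.uniformEquicontinuous _ C hLip).equicontinuous
    rintro _ ρ ⟨φ, hφ, rfl⟩
    have h1 := norm_segment_sub_le hη L (mem_closedBall_zero_iff.mp hφ) ρ
      ⟨0, left_mem_Icc.mpr zero_le_one⟩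
    rw [segment_zero, sub_zero, sub_zero, Real.norm_of_nonneg ρ.2.1] at h1
    rw [mem_closedBall_zero_iff]
    exact h1.trans (mul_le_of_le_one_right C.2 ρ.2.2)
  refine ⟨extendFun η '' closure 𝒜, hcomp.image lipschitzWith_extendFun.continuous, ?_⟩
  refine mem_of_superset (Metric.closedBall_mem_nhds (0 : BUC η E) one_pos) fun φ hφ => ?_
  exact ⟨_, subset_closure ⟨φ, hφ, rfl⟩, (semigroup_one_sub_shiftL hη L φ).symm⟩

end Compactness

/-- Exponential stability of a linear delay equation without characteristic values in the closed
right half-plane. -/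
theorem exists_norm_semigroup_le {η : ℝ} {E : Type*} [NormedAddCommGroup E] [NormedSpace ℝ E]
    [NormedSpace ℂ E] [IsScalarTower ℝ ℂ E] [CompleteSpace E] [ProperSpace E]
    (hη : 0 < η) (L : BUC η E →L[ℂ] E)
    (hL : ∀ (z : ℂ) (c : BUC η E),
      (∀ θ : Iic (0 : ℝ), c θ = Complex.exp (z * (θ : ℝ)) • c BUC.endpoint) →
      z • c BUC.endpoint = L c → c BUC.endpoint ≠ 0 → z.re < 0) {a : ℝ} (ha : 0 < a) :
    ∃ m : ℕ, 0 < m ∧ ‖semigroup hη.le L m‖ ≤ a := by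
  simp only [← semigroup_pow]
  refine exists_norm_pow_le (fun μ hμ => ?_) ha
  by_contra! h1
  obtain ⟨φ, hφ, hφμ⟩ := exists_eigenvector_of_mem_spectrum (norm_shiftL_lt_one hη)
    (isCompactOperator_semigroup_one_sub hη.le L) h1 hμ
  obtain ⟨z, c, hz, hc0, hc, hzc⟩ := exists_eigenfunction hη.le L hφ h1 hφμ
  exact absurd (hL z c hc hzc hc0) (not_lt.mpr hz)

end InfiniteDelay

namespace InfiniteDelay

open Set Filter Topology MeasureTheory

variable {n : ℕ} {η : ℝ}

/-! ### Complexification -/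

namespace BUC

variable {E G : Type*} [NormedAddCommGroup E] [NormedSpace ℝ E] [NormedAddCommGroup G]
  [NormedSpace ℝ G]

@[simp] theorem comp_apply (T : E →L[ℝ] G) (φ : BUC η E) (θ : Iic (0 : ℝ)) :
    φ.comp T θ = T (φ θ) := rfl

variable (η) in
/-- Composition with a bounded linear map as a bounded linear map. -/
def compL (T : E →L[ℝ] G) : BUC η E →L[ℝ] BUC η G :=
  LinearMap.mkContinuous
    { toFun := fun φ => φ.comp T
      map_add' := fun φ ψ => DFunLike.ext _ _ fun θ => map_add T _ _
      map_smul' := fun c φ => DFunLike.ext _ _ fun θ => map_smul T _ _ } ‖T‖ fun φ =>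
    norm_le _ fun θ => by
      change Real.exp (η * θ) * ‖T (φ θ)‖ ≤ _
      calc Real.exp (η * θ) * ‖T (φ θ)‖ ≤ Real.exp (η * θ) * (‖T‖ * ‖φ θ‖) := by
            gcongr; exact T.le_opNorm _
        _ = ‖T‖ * (Real.exp (η * θ) * ‖φ θ‖) := by ring
        _ ≤ ‖T‖ * ‖φ‖ := by gcongr; exact weight_le_norm φ θ

theorem norm_comp_eq {T : E →L[ℝ] G} (hT : ∀ x, ‖T x‖ = ‖x‖) (φ : BUC η E) :
    ‖φ.comp T‖ = ‖φ‖ := by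
  simp only [norm_def, comp_apply, hT]

end BUC

/-- The inclusion `ℝⁿ → ℂⁿ`. -/
def ofRealL (n : ℕ) : EuclideanSpace ℝ (Fin n) →L[ℝ] EuclideanSpace ℂ (Fin n) :=
  LinearMap.toContinuousLinearMap
    { toFun := fun v => WithLp.toLp 2 fun i => (v i : ℂ)
      map_add' := fun v w => by ext i; simp
      map_smul' := fun c v => by ext i; simp }

@[simp] theorem ofRealL_apply (v : EuclideanSpace ℝ (Fin n)) (i : Fin n) :
    ofRealL n v i = (v i : ℂ) := rfl

@[simp] theorem reL_apply (v : EuclideanSpace ℂ (Fin n)) (i : Fin n) : reL n v i = (v i).re := rfl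

@[simp] theorem imL_apply (v : EuclideanSpace ℂ (Fin n)) (i : Fin n) : imL n v i = (v i).im := rfl

theorem norm_ofRealL (v : EuclideanSpace ℝ (Fin n)) : ‖ofRealL n v‖ = ‖v‖ := by
  simp [EuclideanSpace.norm_eq]

theorem reL_ofRealL (v : EuclideanSpace ℝ (Fin n)) : reL n (ofRealL n v) = v := by
  ext i; simp

theorem imL_ofRealL (v : EuclideanSpace ℝ (Fin n)) : imL n (ofRealL n v) = 0 := by
  ext i; simp

variable (Lhat : BUC η (EuclideanSpace ℝ (Fin n)) →L[ℝ] EuclideanSpace ℝ (Fin n))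

/-- The complexification of `Lhat` as a complex-linear map. -/
def complexifyL : BUC η (EuclideanSpace ℂ (Fin n)) →L[ℂ] EuclideanSpace ℂ (Fin n) where
  toFun φ := WithLp.toLp 2 (complexify Lhat φ)
  map_add' φ ψ := by
    ext i
    have h1 : (φ + ψ).comp (reL n) = φ.comp (reL n) + ψ.comp (reL n) :=
      map_add (BUC.compL η (reL n)) φ ψ
    have h2 : (φ + ψ).comp (imL n) = φ.comp (imL n) + ψ.comp (imL n) :=
      map_add (BUC.compL η (imL n)) φ ψ
    simp only [complexify, h1, h2, map_add, PiLp.add_apply]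
    push_cast
    ring
  map_smul' c φ := by
    ext i
    have h1 : (c • φ).comp (reL n) = c.re • φ.comp (reL n) - c.im • φ.comp (imL n) :=
      DFunLike.ext _ _ fun θ => by ext i; simp
    have h2 : (c • φ).comp (imL n) = c.re • φ.comp (imL n) + c.im • φ.comp (reL n) :=
      DFunLike.ext _ _ fun θ => by ext i; simp
    simp only [complexify, h1, h2, map_add, map_sub, map_smul, PiLp.add_apply, PiLp.sub_apply,
      PiLp.smul_apply, smul_eq_mul, RingHom.id_apply]
    conv_rhs => rw [← Complex.re_add_im c]
    push_cast
    linear_combination (-(c.im : ℂ) * (Lhat (φ.comp (imL n)) i : ℂ)) * Complex.I_mul_I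
  cont := by
    refine (PiLp.continuous_toLp 2 _).comp (continuous_pi fun i => ?_)
    have h : ∀ T : EuclideanSpace ℂ (Fin n) →L[ℝ] EuclideanSpace ℝ (Fin n),
        Continuous fun φ : BUC η (EuclideanSpace ℂ (Fin n)) => ((Lhat (φ.comp T) i : ℝ) : ℂ) :=
      fun T => Complex.continuous_ofReal.comp
        ((EuclideanSpace.proj i).continuous.comp (Lhat.continuous.comp (BUC.compL η T).continuous))
    exact (h _).add (continuous_const.mul (h _))

theorem complexifyL_apply (φ : BUC η (EuclideanSpace ℂ (Fin n))) (i : Fin n) :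
    complexifyL Lhat φ i = complexify Lhat φ i := rfl

theorem complexifyL_ofReal (φ : BUC η (EuclideanSpace ℝ (Fin n))) :
    complexifyL Lhat (φ.comp (ofRealL n)) = ofRealL n (Lhat φ) := by
  have h1 : (φ.comp (ofRealL n)).comp (reL n) = φ := DFunLike.ext _ _ fun θ => reL_ofRealL _
  have h2 : (φ.comp (ofRealL n)).comp (imL n) = 0 := DFunLike.ext _ _ fun θ => imL_ofRealL _
  ext i
  rw [complexifyL_apply, complexify, h1, h2, map_zero]
  simp

/-- An exponential eigenfunction makes the characteristic matrix singular. -/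
theorem det_charMatrix_eq_zero {z : ℂ} (hz : -η < z.re) {c : BUC η (EuclideanSpace ℂ (Fin n))}
    (hc : ∀ θ : Iic (0 : ℝ), c θ = Complex.exp (z * (θ : ℝ)) • c BUC.endpoint)
    (hzc : z • c BUC.endpoint = complexifyL Lhat c) (h0 : c BUC.endpoint ≠ 0) :
    (charMatrix Lhat z hz).det = 0 := by
  set w := c BUC.endpoint with hw
  -- Expanding `c = e^{z·} w` in the columns `e^{z·} e_j` turns `z w = L c` into `Δ(z) w = 0`.
  have hsum : c = ∑ j, w j • BUC.expFun (η := η) z hz (EuclideanSpace.single j 1) := by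
    have hev : ∀ (θ : Iic (0 : ℝ)) (s : Finset (Fin n)),
        (∑ j ∈ s, w j • BUC.expFun (η := η) z hz (EuclideanSpace.single j 1)) θ =
        ∑ j ∈ s, w j • Complex.exp (z * (θ : ℝ)) • EuclideanSpace.single j (1 : ℂ) := fun θ s =>
      map_sum (BUC.evalL η (EuclideanSpace ℂ (Fin n)) θ) _ s
    refine DFunLike.ext _ _ fun θ => ?_
    rw [hev, hc θ]
    ext i
    simp [Pi.single_apply, mul_comm]
  refine Matrix.exists_mulVec_eq_zero_iff.mp ⟨fun i => w i, fun h => h0 ?_, ?_⟩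
  · ext i
    exact congrFun h i
  · funext i
    have h1 : z * w i = ∑ j, w j *
        complexify Lhat (BUC.expFun (η := η) z hz (EuclideanSpace.single j 1)) i := by
      have h2 := congrArg (fun v : EuclideanSpace ℂ (Fin n) => v i) hzc
      rw [hsum, map_sum] at h2
      simpa [complexifyL_apply] using h2
    rw [charMatrix, Matrix.sub_mulVec, Matrix.smul_mulVec, Matrix.one_mulVec]
    simp only [Pi.sub_apply, Pi.smul_apply, smul_eq_mul, Pi.zero_apply, Matrix.mulVec, dotProduct,
      Matrix.of_apply]
    rw [h1, sub_eq_zero]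
    exact Finset.sum_congr rfl fun j _ => mul_comm _ _

/-! ### Truncation of the nonlinearity -/

section Truncation

variable {V W : Type*} [NormedAddCommGroup V] [NormedSpace ℝ V] [NormedAddCommGroup W]
  [NormedSpace ℝ W]

/-- The radial retraction onto the ball of radius `r`. -/
def radial (r : ℝ) (x : V) : V := (r / max r ‖x‖) • x

theorem radial_of_norm_le {r : ℝ} (hr : 0 < r) {x : V} (hx : ‖x‖ ≤ r) : radial r x = x := by
  rw [radial, max_eq_left hx, div_self hr.ne', one_smul]

theorem norm_radial_le_norm {r : ℝ} (hr : 0 < r) (x : V) : ‖radial r x‖ ≤ ‖x‖ := by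
  have h : 0 < max r ‖x‖ := lt_max_of_lt_left hr
  rw [radial, norm_smul, Real.norm_of_nonneg (by positivity)]
  exact mul_le_of_le_one_left (norm_nonneg x) ((div_le_one h).mpr (le_max_left _ _))

theorem norm_radial_le {r : ℝ} (hr : 0 < r) (x : V) : ‖radial r x‖ ≤ r := by
  have h : 0 < max r ‖x‖ := lt_max_of_lt_left hr
  rw [radial, norm_smul, Real.norm_of_nonneg (by positivity), div_mul_eq_mul_div, div_le_iff₀ h]
  exact mul_le_mul_of_nonneg_left (le_max_right _ _) hr.le

/-- The difference splits into a change of point and a change of scaling factor, each at most `‖x -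
y‖`; no inner product is needed. -/
theorem norm_radial_sub_le {r : ℝ} (hr : 0 < r) (x y : V) :
    ‖radial r x - radial r y‖ ≤ 2 * ‖x - y‖ := by
  set a := max r ‖x‖ with ha
  set b := max r ‖y‖ with hb
  have ha0 : 0 < a := lt_max_of_lt_left hr
  have hb0 : 0 < b := lt_max_of_lt_left hr
  have h1 : radial r x - radial r y = (r / a) • (x - y) + (r / a * ((b - a) / b)) • y := by
    have h2 : r / a * ((b - a) / b) = r / a - r / b := by field_simp
    rw [radial, radial, h2, smul_sub, sub_smul]
    abel
  have h3 : r / a ≤ 1 := (div_le_one ha0).mpr (le_max_left _ _)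
  have h4 : |b - a| ≤ ‖x - y‖ := by
    rw [norm_sub_rev]
    refine (abs_max_sub_max_le_max r ‖y‖ r ‖x‖).trans ?_
    rw [sub_self, abs_zero, max_eq_right (abs_nonneg _)]
    exact abs_norm_sub_norm_le y x
  have h5 : ‖y‖ / b ≤ 1 := (div_le_one hb0).mpr (le_max_right _ _)
  rw [h1]
  refine (norm_add_le _ _).trans ?_
  rw [norm_smul, norm_smul, norm_mul, norm_div (b - a), Real.norm_of_nonneg hb0.le,
    Real.norm_of_nonneg (by positivity : 0 ≤ r / a), Real.norm_eq_abs]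
  calc r / a * ‖x - y‖ + r / a * (|b - a| / b) * ‖y‖
      = r / a * ‖x - y‖ + r / a * |b - a| * (‖y‖ / b) := by ring
    _ ≤ 1 * ‖x - y‖ + 1 * ‖x - y‖ * 1 := by gcongr
    _ = 2 * ‖x - y‖ := by ring

/-- A function differentiable at its zero `0` and Lipschitz on balls agrees near `0` with a globally
Lipschitz function that is globally close to the derivative. -/
theorem exists_truncation {f : V → W} {L : V →L[ℝ] W}
    (hLip : ∀ ξ : ℝ, 0 < ξ → ∃ κ : ℝ, ∀ x y : V, ‖x‖ ≤ ξ → ‖y‖ ≤ ξ → ‖f x - f y‖ ≤ κ * ‖x - y‖)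
    (hf0 : f 0 = 0) (hL : HasFDerivAt f L 0) {ε : ℝ} (hε : 0 < ε) :
    ∃ (r : ℝ) (κ : ℝ≥0) (g : V → W), 0 < r ∧ LipschitzWith κ g ∧ (∀ x, ‖x‖ ≤ r → g x = f x) ∧
      ∀ x, ‖g x - L x‖ ≤ ε * ‖x‖ := by
  have h1 := (hasFDerivAt_iff_isLittleO_nhds_zero.mp hL).def hε
  obtain ⟨r, hr, h2⟩ := Metric.nhds_basis_closedBall.eventually_iff.mp h1
  have h3 : ∀ x, ‖x‖ ≤ r → ‖f x - L x‖ ≤ ε * ‖x‖ := fun x hx => by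
    simpa [hf0] using h2 (mem_closedBall_zero_iff.mpr hx)
  obtain ⟨κ, hκ⟩ := hLip r hr
  -- Only the remainder `f - L` is precomposed with the retraction. It stays below `ε ‖x‖`
  -- everywhere because the retraction does not increase norms.
  refine ⟨r, ⟨‖L‖ + (max κ 0 + ‖L‖) * 2, by positivity⟩,
    fun x => L x + (f (radial r x) - L (radial r x)), hr, ?_, fun x hx => ?_, fun x => ?_⟩
  · refine LipschitzWith.of_dist_le_mul fun x y => ?_
    rw [dist_eq_norm, dist_eq_norm]
    have h4 : L x + (f (radial r x) - L (radial r x)) - (L y + (f (radial r y) - L (radial r y))) =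
        L (x - y) + (f (radial r x) - f (radial r y) - L (radial r x - radial r y)) := by
      rw [map_sub, map_sub]; abel
    have h5 := norm_radial_sub_le hr x y
    have h6 : ‖f (radial r x) - f (radial r y)‖ ≤ max κ 0 * (2 * ‖x - y‖) := by
      refine (hκ _ _ (norm_radial_le hr x) (norm_radial_le hr y)).trans ?_
      gcongr
      exact le_max_left _ _
    have h7 : ‖L (radial r x - radial r y)‖ ≤ ‖L‖ * (2 * ‖x - y‖) :=
      (L.le_opNorm _).trans (by gcongr)
    rw [h4]
    calc _ ≤ ‖L (x - y)‖ + (‖f (radial r x) - f (radial r y)‖ + ‖L (radial r x - radial r y)‖) :=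
          (norm_add_le _ _).trans (add_le_add_right (norm_sub_le _ _) _)
      _ ≤ ‖L‖ * ‖x - y‖ + (max κ 0 * (2 * ‖x - y‖) + ‖L‖ * (2 * ‖x - y‖)) := by
          gcongr; exact L.le_opNorm _
      _ = (‖L‖ + (max κ 0 + ‖L‖) * 2) * ‖x - y‖ := by ring
  · simp only [radial_of_norm_le hr hx]
    abel
  · rw [add_sub_cancel_left]
    refine (h3 _ (norm_radial_le hr x)).trans ?_
    gcongr
    exact norm_radial_le_norm hr x

end Truncation

/-! ### Nonlinear stability -/

/-- Iterating a uniform contraction at time `m` gives exponential decay. -/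
theorem exponential_decay_of_contraction {E : Type*} [NormedAddCommGroup E] [NormedSpace ℝ E]
    {g : BUC η E → E} (hgc : Continuous g) {m K : ℝ} (hm : 0 < m) (hK : 0 ≤ K)
    (hcontr : ∀ φ v, IsDelaySolution g φ m v → ‖v m‖ ≤ 1 / 2 * ‖φ‖)
    (hbound : ∀ φ v, IsDelaySolution g φ m v → ∀ t ∈ Icc 0 m, ‖v t‖ ≤ K * ‖φ‖)
    {φ : BUC η E} {v : ℝ → BUC η E} (hv : ∀ τ, IsDelaySolution g φ τ v) {t : ℝ} (ht : 0 ≤ t) :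
    ‖v t‖ ≤ 2 * K * Real.exp (-(Real.log 2 / m) * t) * ‖φ‖ := by
  have htr : ∀ k : ℕ, IsDelaySolution g (v (k * m)) m fun s => v (k * m + s) := fun k =>
    (hv _).translate hgc (by positivity) hm.le le_rfl
  have hk : ∀ k : ℕ, ‖v (k * m)‖ ≤ (1 / 2) ^ k * ‖φ‖ := by
    intro k
    induction k with
    | zero => simp [(hv 0).apply_zero le_rfl]
    | succ k ih =>
      have h1 := hcontr _ _ (htr k)
      have h2 : ((k + 1 : ℕ) : ℝ) * m = k * m + m := by push_cast; ring
      rw [h2, pow_succ']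
      calc _ ≤ 1 / 2 * ‖v (k * m)‖ := h1
        _ ≤ 1 / 2 * ((1 / 2) ^ k * ‖φ‖) := by gcongr
        _ = _ := by ring
  -- The norm is halved `k` times up to `k * m`, and `hbound` covers the rest. As `k > t/m - 1`,
  -- rounding costs the factor `2`.
  set k := ⌊t / m⌋₊ with hkdef
  have h1 : (k : ℝ) * m ≤ t := (le_div_iff₀ hm).mp (Nat.floor_le (by positivity))
  have h2 : t / m < k + 1 := Nat.lt_floor_add_one _
  have h3 : t < (k + 1) * m := (div_lt_iff₀ hm).mp h2
  have h4 := hbound _ _ (htr k) (t - k * m) ⟨by linarith, by linarith⟩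
  rw [add_sub_cancel] at h4
  have h5 : ((1 : ℝ) / 2) ^ k ≤ 2 * Real.exp (-(Real.log 2 / m) * t) := by
    have h6 : ((1 : ℝ) / 2) ^ k = Real.exp (-(Real.log 2 * k)) := by
      rw [Real.exp_neg, mul_comm, Real.exp_nat_mul, Real.exp_log two_pos, one_div, inv_pow]
    have h7 : 2 * Real.exp (-(Real.log 2 / m) * t) =
        Real.exp (Real.log 2 + -(Real.log 2 / m) * t) := by
      rw [Real.exp_add, Real.exp_log two_pos]
    rw [h6, h7, Real.exp_le_exp]
    have h8 : Real.log 2 / m * t = Real.log 2 * (t / m) := by ring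
    nlinarith [Real.log_pos one_lt_two]
  calc ‖v t‖ ≤ K * ‖v (k * m)‖ := h4
    _ ≤ K * ((2 * Real.exp (-(Real.log 2 / m) * t)) * ‖φ‖) := by
        gcongr
        exact (hk k).trans (by gcongr)
    _ = _ := by ring

/-- The trajectory of a perturbed linear equation stays close to that of the complexified linear
equation. -/
theorem norm_comp_sub_semigroup_le (hη : 0 ≤ η)
    {g : BUC η (EuclideanSpace ℝ (Fin n)) → EuclideanSpace ℝ (Fin n)} (hg : Continuous g) {ε : ℝ}
    (hε : 0 ≤ ε) (hε1 : ε ≤ 1) (hgL : ∀ φ, ‖g φ - Lhat φ‖ ≤ ε * ‖φ‖)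
    {φ : BUC η (EuclideanSpace ℝ (Fin n))} {τ : ℝ} (hτ : 0 ≤ τ)
    {v : ℝ → BUC η (EuclideanSpace ℝ (Fin n))} (hv : IsDelaySolution g φ τ v) :
    (∀ t ∈ Icc 0 τ, ‖v t‖ ≤ ‖φ‖ * Real.exp ((‖Lhat‖ + 1) * t)) ∧
    ‖(v τ).comp (ofRealL n) - semigroup hη (complexifyL Lhat) τ (φ.comp (ofRealL n))‖ ≤
      ε * (‖φ‖ * Real.exp ((‖Lhat‖ + 1) * τ)) * τ * Real.exp (‖complexifyL Lhat‖ * τ) := by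
  have hgn : ∀ ψ, ‖g ψ‖ ≤ (‖Lhat‖ + 1) * ‖ψ‖ := fun ψ => by
    calc ‖g ψ‖ = ‖Lhat ψ + (g ψ - Lhat ψ)‖ := by rw [add_sub_cancel]
      _ ≤ ‖Lhat‖ * ‖ψ‖ + 1 * ‖ψ‖ := (norm_add_le _ _).trans
          (add_le_add (Lhat.le_opNorm _) ((hgL ψ).trans (by gcongr)))
      _ = _ := by ring
  have hb := hv.norm_le hη (by positivity) fun s _ => hgn (v s)
  refine ⟨hb, ?_⟩
  have hcomp : ∀ ψ : BUC η (EuclideanSpace ℝ (Fin n)), (ψ.comp (ofRealL n)).comp (reL n) = ψ :=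
    fun ψ => DFunLike.ext _ _ fun θ => reL_ofRealL _
  -- Precomposing `g` with the real part makes the embedded real trajectory a solution of a complex
  -- delay equation, comparable with the semigroup.
  have hvC : IsDelaySolution (fun ψ : BUC η (EuclideanSpace ℂ (Fin n)) =>
      ofRealL n (g (ψ.comp (reL n)))) (φ.comp (ofRealL n)) τ fun t => (v t).comp (ofRealL n) := by
    refine ⟨(BUC.compL η (ofRealL n)).continuous.comp_continuousOn hv.continuousOn,
      fun t ht θ => ?_⟩
    have hθ : (θ : ℝ) ≤ 0 := θ.2
    simp only [hcomp, BUC.comp_apply, hv.apply_eq t ht, orbit, map_add]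
    congr 1
    refine ((ofRealL n).intervalIntegral_comp_comm ?_).symm
    refine ((hg.comp_continuousOn hv.continuousOn).mono ?_).intervalIntegrable
    rw [uIcc_of_le (le_max_right _ _)]
    exact Icc_subset_Icc_right (max_le (by linarith [ht.2]) hτ)
  have hgC : ContinuousOn (fun s => ofRealL n (g (((v s).comp (ofRealL n)).comp (reL n)))) (Icc 0 τ) := by
    simp only [hcomp]
    exact (ofRealL n).continuous.comp_continuousOn (hg.comp_continuousOn hv.continuousOn)
  refine IsDelaySolution.norm_sub_le hη (norm_nonneg (complexifyL Lhat)) (by positivity) hvC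
    (isDelaySolution_semigroup hη (complexifyL Lhat) (φ.comp (ofRealL n)) τ) hgC
    ((complexifyL Lhat).continuous.comp (continuous_semigroup_apply hη _ _)).continuousOn
    (fun s hs => ?_) τ (right_mem_Icc.mpr hτ)
  rw [hcomp]
  have h1 : ofRealL n (g (v s)) - complexifyL Lhat (semigroup hη (complexifyL Lhat) s (φ.comp (ofRealL n))) =
      complexifyL Lhat ((v s).comp (ofRealL n) -
        semigroup hη (complexifyL Lhat) s (φ.comp (ofRealL n))) + ofRealL n (g (v s) - Lhat (v s)) := by
    rw [map_sub, map_sub, complexifyL_ofReal]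
    abel
  rw [h1]
  refine (norm_add_le _ _).trans (add_le_add ((complexifyL Lhat).le_opNorm _) ?_)
  rw [norm_ofRealL]
  refine (hgL _).trans ?_
  gcongr
  refine (hb s hs).trans ?_
  gcongr
  exact hs.2

/-- Principle of linearized stability for the delay equation. -/
theorem exists_exponential_decay (hη : 0 < η)
    {f : BUC η (EuclideanSpace ℝ (Fin n)) → EuclideanSpace ℝ (Fin n)} (hLip : LipschitzOnBounded f)
    (hf0 : f 0 = 0) (hL : HasFDerivAt f Lhat 0)
    (hΔ : ∀ (z : ℂ) (hz : -η < z.re), (charMatrix Lhat z hz).det = 0 → z.re < 0) :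
    ∃ M δ ε : ℝ, 1 ≤ M ∧ 0 < δ ∧ 0 < ε ∧ ∀ φ : BUC η (EuclideanSpace ℝ (Fin n)), ‖φ‖ ≤ ε →
      ∃ v : ℝ → BUC η (EuclideanSpace ℝ (Fin n)), (∀ τ, IsDelaySolution f φ τ v) ∧
        ∀ t, 0 ≤ t → ‖v t‖ ≤ M * Real.exp (-δ * t) * ‖φ‖ := by
  -- The linear part at time `m` may use `1/4`; the truncation error below uses another `1/4`, for a
  -- contraction factor `1/2`.
  obtain ⟨m, hm, hTm⟩ := exists_norm_semigroup_le hη (complexifyL Lhat)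
    (fun z c hc hzc hc0 => by
      by_contra! h
      have hz : -η < z.re := by linarith
      exact absurd (hΔ z hz (det_charMatrix_eq_zero Lhat hz hc hzc hc0)) (not_lt.mpr h))
    (a := 1 / 4) (by norm_num)
  have hm0 : (0 : ℝ) < m := by exact_mod_cast hm
  set K : ℝ := Real.exp ((‖Lhat‖ + 1) * m) with hKdef
  set Q : ℝ := K * m * Real.exp (‖complexifyL Lhat‖ * m) with hQdef
  have hQ : 0 < Q := by positivity
  -- `ε * Q` is the error factor of `norm_comp_sub_semigroup_le` at time `m`.
  set ε : ℝ := min 1 (1 / 4 / Q) with hεdef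
  have hε : 0 < ε := by positivity
  have hεQ : ε * Q ≤ 1 / 4 := (le_div_iff₀ hQ).mp (min_le_right _ _)
  obtain ⟨r, κ, g, hr, hg, hgf, hgL⟩ := exists_truncation hLip hf0 hL hε
  have hg0 : g 0 = 0 := by rw [hgf 0 (by simpa using hr.le), hf0]
  have hK1 : 1 ≤ K := Real.one_le_exp (by positivity)
  have hbound : ∀ φ v, IsDelaySolution g φ m v → ∀ t ∈ Icc 0 (m : ℝ), ‖v t‖ ≤ K * ‖φ‖ := by
    intro φ v hv t ht
    refine ((norm_comp_sub_semigroup_le Lhat hη.le hg.continuous hε.le (min_le_left _ _) hgL hm0.le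
      hv).1 t ht).trans ?_
    rw [mul_comm]
    exact mul_le_mul_of_nonneg_right (Real.exp_le_exp.mpr (by gcongr; exact ht.2)) (norm_nonneg _)
  have hcontr : ∀ φ v, IsDelaySolution g φ m v → ‖v m‖ ≤ 1 / 2 * ‖φ‖ := by
    intro φ v hv
    have h1 := (norm_comp_sub_semigroup_le Lhat hη.le hg.continuous hε.le (min_le_left _ _) hgL
      hm0.le hv).2
    have h2 := (semigroup hη.le (complexifyL Lhat) m).le_of_opNorm_le hTm (φ.comp (ofRealL n))
    rw [BUC.norm_comp_eq norm_ofRealL] at h2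
    rw [← BUC.norm_comp_eq norm_ofRealL]
    have h3 := norm_le_norm_add_norm_sub' ((v m).comp (ofRealL n))
      (semigroup hη.le (complexifyL Lhat) m (φ.comp (ofRealL n)))
    have h4 : ε * (‖φ‖ * K) * m * Real.exp (‖complexifyL Lhat‖ * m) ≤ 1 / 4 * ‖φ‖ := by
      calc _ = ε * Q * ‖φ‖ := by rw [hQdef]; ring
        _ ≤ _ := by gcongr
    linarith
  -- For `‖φ‖ ≤ r / (2K)` the global solution of the truncated equation stays in the ball of radius
  -- `r`, where `g = f`, so no continuation argument is needed.
  refine ⟨2 * K, Real.log 2 / m, r / (2 * K), by linarith, by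
    have := Real.log_pos one_lt_two
    positivity, by positivity, fun φ hφ => ?_⟩
  obtain ⟨v, -, hv⟩ := exists_isDelaySolution hη.le hg hg0 φ
  have hdecay : ∀ t, 0 ≤ t → ‖v t‖ ≤ 2 * K * Real.exp (-(Real.log 2 / m) * t) * ‖φ‖ := fun t ht =>
    exponential_decay_of_contraction hg.continuous hm0 (by positivity) hcontr hbound hv ht
  refine ⟨v, fun τ => (hv τ).congr (fun _ _ => rfl) fun t ht => hgf _ ?_, hdecay⟩
  have h1 : Real.exp (-(Real.log 2 / m) * t) ≤ 1 := by
    refine Real.exp_le_one_iff.mpr (mul_nonpos_of_nonpos_of_nonneg (neg_nonpos.mpr ?_) ht.1)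
    have := Real.log_pos one_lt_two
    positivity
  calc ‖v t‖ ≤ 2 * K * Real.exp (-(Real.log 2 / m) * t) * ‖φ‖ := hdecay t ht.1
    _ ≤ 2 * K * 1 * (r / (2 * K)) := by gcongr
    _ = r := by field_simp

/-! ### The semiflow -/

theorem norm_of_fst_eq_zero {x : X n η} (hx : x.fst = 0) : ‖x‖ = ‖x.snd‖ := by
  rw [WithLp.prod_norm_eq_of_L1, hx, norm_zero, zero_add]

theorem IsMildSolution.eqOn (hη : 0 ≤ η)
    {f : BUC η (EuclideanSpace ℝ (Fin n)) → EuclideanSpace ℝ (Fin n)} (hLip : LipschitzOnBounded f)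
    {x : X n η} (hx : x ∈ X₀ n η) {τ : ℝ} {v w : ℝ → X n η} (hv : IsMildSolution f x τ v)
    (hw : IsMildSolution f x τ w) : EqOn v w (Icc 0 τ) := by
  rw [isMildSolution_iff hLip.continuous (mem_X₀_iff.mp hx)] at hv hw
  intro t ht
  refine WithLp.ofLp_injective 1 (Prod.ext ?_ ?_)
  · exact (hv.1 t ht).trans (hw.1 t ht).symm
  · exact hv.2.eqOn hη hLip hLip.continuous hw.2 ht

theorem IsMildSolution.mono {f : BUC η (EuclideanSpace ℝ (Fin n)) → EuclideanSpace ℝ (Fin n)}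
    {x : X n η} {τ : ℝ} {v : ℝ → X n η} (hv : IsMildSolution f x τ v) {σ : ℝ} (h : σ ≤ τ) :
    IsMildSolution f x σ v :=
  ⟨hv.continuousOn.mono (Icc_subset_Icc_right h), fun t ht => hv.mem t ⟨ht.1, ht.2.trans h⟩,
    fun t ht => hv.eq t ⟨ht.1, ht.2.trans h⟩⟩

/-- By uniqueness the value does not depend on which solution on `[0, t]` is chosen. -/
theorem IsMildSolution.U_eq (hη : 0 ≤ η)
    {f : BUC η (EuclideanSpace ℝ (Fin n)) → EuclideanSpace ℝ (Fin n)} (hLip : LipschitzOnBounded f)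
    {x : X n η} (hx : x ∈ X₀ n η) {τ : ℝ} {v : ℝ → X n η} (hv : IsMildSolution f x τ v) {t : ℝ}
    (ht : t ∈ Icc 0 τ) : U f t x = v t := by
  have h : ∃ v, IsMildSolution f x t v := ⟨v, hv.mono ht.2⟩
  rw [U, dif_pos h]
  exact IsMildSolution.eqOn hη hLip hx h.choose_spec (hv.mono ht.2) (right_mem_Icc.mpr ht.1)

theorem IsMildSolution.congr
    {f : BUC η (EuclideanSpace ℝ (Fin n)) → EuclideanSpace ℝ (Fin n)} (hLip : LipschitzOnBounded f)
    {x : X n η} (hx : x ∈ X₀ n η) {τ : ℝ} {v w : ℝ → X n η} (hv : IsMildSolution f x τ v)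
    (h : EqOn v w (Icc 0 τ)) : IsMildSolution f x τ w := by
  rw [isMildSolution_iff hLip.continuous (mem_X₀_iff.mp hx)] at hv ⊢
  refine ⟨fun t ht => by rw [← h ht]; exact hv.1 t ht, hv.2.congr (fun t ht => ?_) fun _ _ => rfl⟩
  exact congrArg WithLp.snd (h ht)

theorem χ_eq_top {f : BUC η (EuclideanSpace ℝ (Fin n)) → EuclideanSpace ℝ (Fin n)} {x : X n η}
    (h : ∀ τ : ℝ≥0, ∃ v, IsMildSolution f x τ v) : χ f x = ⊤ :=
  ENNReal.eq_top_of_forall_nnreal_le fun τ =>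
    le_iSup₂ (f := fun (τ : ℝ≥0) (_ : ∃ v, IsMildSolution f x τ v) => (τ : ℝ≥0∞)) τ (h τ)

/-- Exponential stability implies asymptotic stability. -/
theorem zeroAsymptoticallyStable_of_exponential
    {f : BUC η (EuclideanSpace ℝ (Fin n)) → EuclideanSpace ℝ (Fin n)} {M δ ε : ℝ} (hM : 1 ≤ M)
    (hδ : 0 < δ) (hε : 0 < ε) (h : ∀ x ∈ X₀ n η, ‖x‖ ≤ ε → χ f x = ⊤ ∧
      ∀ t : ℝ, 0 ≤ t → ‖U f t x‖ ≤ M * Real.exp (-δ * t) * ‖x‖) : ZeroAsymptoticallyStable f := by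
  have hM0 : 0 < M := by linarith
  refine ⟨fun ε' hε' => ⟨min ε (ε' / M), by positivity, fun x hx hxr => ?_⟩,
    ε, hε, fun x hx hxr => ⟨(h x hx hxr).1, ?_⟩⟩
  · obtain ⟨h1, h2⟩ := h x hx (hxr.trans (min_le_left _ _))
    refine ⟨h1, fun t ht => (h2 t ht).trans ?_⟩
    have h3 : Real.exp (-δ * t) ≤ 1 := Real.exp_le_one_iff.mpr (by nlinarith)
    calc M * Real.exp (-δ * t) * ‖x‖ ≤ M * 1 * (ε' / M) := by
          gcongr
          exact hxr.trans (min_le_right _ _)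
      _ = ε' := by field_simp
  · have h1 : Tendsto (fun t : ℝ => M * Real.exp (-δ * t) * ‖x‖) atTop (𝓝 0) := by
      have h2 : Tendsto (fun t : ℝ => -δ * t) atTop atBot :=
        tendsto_id.const_mul_atTop_of_neg (neg_lt_zero.mpr hδ)
      simpa using ((Real.tendsto_exp_atBot.comp h2).const_mul M).mul_const ‖x‖
    refine squeeze_zero_norm' ?_ h1
    filter_upwards [eventually_ge_atTop 0] with t ht using (h x hx hxr).2 t ht

end InfiniteDelay

end

/-! ### The stability theorem -/

theorem theorem8p1 {n : ℕ} {η : ℝ} (hη : 0 < η)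
    (f : InfiniteDelay.BUC η (EuclideanSpace ℝ (Fin n)) → EuclideanSpace ℝ (Fin n))
    (hLip : InfiniteDelay.LipschitzOnBounded f)
    (hf0 : f 0 = 0)
    (hC1 : ∃ r : ℝ, 0 < r ∧ ContDiffOn ℝ 1 f (Metric.ball 0 r))
    (hΔ : ∀ (z : ℂ) (hz : -η < z.re),
      (InfiniteDelay.charMatrix (fderiv ℝ f 0) z hz).det = 0 → z.re < 0) :
    InfiniteDelay.ZeroAsymptoticallyStable f ∧
    ∃ M δ ε : ℝ, 1 ≤ M ∧ 0 < δ ∧ 0 < ε ∧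
      ∀ x ∈ InfiniteDelay.X₀ n η, ‖x‖ ≤ ε →
        InfiniteDelay.χ f x = ⊤ ∧
        (∀ τ : ℝ, 0 ≤ τ → ∀ v : ℝ → InfiniteDelay.X n η,
          InfiniteDelay.IsMildSolution f x τ v ↔
            Set.EqOn v (fun t => InfiniteDelay.U f t x) (Set.Icc 0 τ)) ∧
        ∀ t : ℝ, 0 ≤ t →
          ‖InfiniteDelay.U f t x‖ ≤ M * Real.exp (-δ * t) * ‖x‖ := by
  obtain ⟨r, hr, hC⟩ := hC1
  have hL : HasFDerivAt f (fderiv ℝ f 0) 0 :=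
    ((hC.differentiableOn one_ne_zero).differentiableAt (Metric.ball_mem_nhds 0 hr)).hasFDerivAt
  obtain ⟨M, δ, ε, hM, hδ, hε, hv⟩ :=
    InfiniteDelay.exists_exponential_decay (fderiv ℝ f 0) hη hLip hf0 hL hΔ
  have key : ∀ x ∈ InfiniteDelay.X₀ n η, ‖x‖ ≤ ε →
      InfiniteDelay.χ f x = ⊤ ∧
      (∀ τ : ℝ, 0 ≤ τ → ∀ v : ℝ → InfiniteDelay.X n η,
        InfiniteDelay.IsMildSolution f x τ v ↔
          Set.EqOn v (fun t => InfiniteDelay.U f t x) (Set.Icc 0 τ)) ∧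
      ∀ t : ℝ, 0 ≤ t →
        ‖InfiniteDelay.U f t x‖ ≤ M * Real.exp (-δ * t) * ‖x‖ := by
    intro x hx hxε
    have hx0 := InfiniteDelay.mem_X₀_iff.mp hx
    have hnorm := InfiniteDelay.norm_of_fst_eq_zero hx0
    obtain ⟨v, hsol, hdecay⟩ := hv x.snd (hnorm ▸ hxε)
    -- The delay trajectory, placed in `{0} × BUC_η`, is a mild solution on every interval and hence
    -- the semiflow.
    set w : ℝ → InfiniteDelay.X n η := fun t => WithLp.toLp 1 (0, v t) with hw
    have hmild : ∀ τ, InfiniteDelay.IsMildSolution f x τ w := fun τ =>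
      (InfiniteDelay.isMildSolution_iff hLip.continuous hx0).mpr ⟨fun _ _ => rfl, hsol τ⟩
    have hU : ∀ t, 0 ≤ t → InfiniteDelay.U f t x = w t := fun t ht =>
      (hmild t).U_eq hη.le hLip hx (Set.right_mem_Icc.mpr ht)
    refine ⟨InfiniteDelay.χ_eq_top fun τ => ⟨w, hmild τ⟩, fun τ _ v' => ⟨fun h t ht => ?_, fun h => ?_⟩,
      fun t ht => ?_⟩
    · exact (h.U_eq hη.le hLip hx ht).symm
    · exact (hmild τ).congr hLip hx fun t ht => ((h ht).trans (hU t ht.1)).symm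
    · rw [hU t ht, InfiniteDelay.norm_of_fst_eq_zero (x := w t) rfl, hnorm]
      exact hdecay t ht
  exact ⟨InfiniteDelay.zeroAsymptoticallyStable_of_exponential hM hδ hε fun x hx hxε =>
    ⟨(key x hx hxε).1, (key x hx hxε).2.2⟩, M, δ, ε, hM, hδ, hε, key⟩
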